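/- Let $S^2\subset\mathbb R^3$ be the unit sphere. A classical wave map on $\mathbb R^2\times(0,1]$ is a smooth map $u:\mathbb R^2\times(0,1]\to S^2$ that equals a fixed constant $u_\infty\in S^2$ for all $|x|\ge R$ and $t\in(0,1]$, with some $R$, and solves $$\partial_{tt}u-\Delta u=(|\nabla u|^2-|\partial_tu|^2)\,u .$$ Its (conserved) energy is $E=\int_{\mathbb R^2}\big(\tfrac{|\nabla u|^2}{2}+\tfrac{|\partial_tu|^2}{2}\big)(x,t)\,dx$, where $t\in(0,1]$ is arbitrary. Its energy flux through the light cone is $$\mathrm{Flux}(t_1,t_2)=\frac1{\sqrt2}\int_{t_1}^{t_2}\int_{|x|=t}\Big(\frac{|\nabla u|^2}{2}+\frac{|\partial_tu|^2}{2}+\frac{x}{|x|}\cdot\nabla u^{\dagger}\,\partial_tu\Big)\,d\sigma\,dt ,$$ where $d\sigma$ is arc length on the circle $|x|=t$, $u^\dagger$ is the transpose of the column vector $u$, and $y\cdot\nabla u^\dagger\,\partial_tu=\sum_{j=1}^2 y_j\,\partial_ju\cdot\partial_tu$. **Theorem.** There is a universal constant $C>0$ such that the following holds. Let $u$ be a classical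 wave map on $\mathbb R^2\times(0,1]$ with energy $E$, let $\epsilon\in(0,1)$ and $0<\bar t<1$, and suppose that $\mathrm{Flux}(0,\bar t)<\epsilon E$. Put $$\rho_{\epsilon\bar t}=\big((t+\epsilon\bar t)^2-|x|^2\big)^{-1/2},\qquad X^\alpha\partial_\alpha u=(t+\epsilon\bar t)\,\partial_tu+x_1\,\partial_{x_1}u+x_2\,\partial_{x_2}u .$$ Then $$\int_{\epsilon\bar t}^{\bar t}\int_{|x|<t}\rho_{\epsilon\bar t}^3\,\big|X^\alpha\partial_\alpha u\big|^2\,dx\,dt+\int_{|x|<\bar t}\bar t\,\rho_{\epsilon\bar t}\Big(\frac{|\nabla u|^2}{2}+\frac{|\partial_tu|^2}{2}+\frac{x}{\bar t}\cdot\nabla u^{\dagger}\,\partial_tu\Big)(x,\bar t)\,dx\le C\,E .$$ -/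

import Mathlib

open Set MeasureTheory
open scoped ContDiff

noncomputable section

namespace WaveMap

/-- The plane `ℝ²` with its Euclidean norm. -/
abbrev Plane : Type := EuclideanSpace ℝ (Fin 2)

/-- The space `ℝ³` with its Euclidean norm; the target `S²` is its unit sphere. -/
abbrev Space : Type := EuclideanSpace ℝ (Fin 3)

/-- `∂ₜ u (t, x)` for a map `u` on `(0,1] × ℝ²`; it is the ordinary derivative for `t < 1` and
the one-sided derivative at `t = 1`. -/
def dt (u : ℝ → Plane → Space) (t : ℝ) (x : Plane) : Space :=
  derivWithin (fun s => u s x) (Ioc 0 1) t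

/-- `∂ₜₜ u (t, x)`. -/
def dtt (u : ℝ → Plane → Space) (t : ℝ) (x : Plane) : Space :=
  derivWithin (fun s => dt u s x) (Ioc 0 1) t

/-- The spatial derivative `y · ∇u (t, x)` in direction `y`. -/
def dx (u : ℝ → Plane → Space) (t : ℝ) (x y : Plane) : Space :=
  fderiv ℝ (u t) x y

/-- `|∇u|² = |∂₁u|² + |∂₂u|²`. -/
def gradSq (u : ℝ → Plane → Space) (t : ℝ) (x : Plane) : ℝ :=
  ∑ j : Fin 2, ‖dx u t x (EuclideanSpace.single j 1)‖ ^ 2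

/-- Classical wave maps `u : (0,1] × ℝ² → S²` (time is the first argument; the values of `u` at
times outside `(0,1]` play no role): smooth solutions of
`∂ₜₜu - Δu = (|∇u|² - |∂ₜu|²) u` with values in the unit sphere, equal to a constant for large
`x`. -/
structure IsClassical (u : ℝ → Plane → Space) : Prop where
  smooth : ContDiffOn ℝ ∞ (fun p : ℝ × Plane => u p.1 p.2) (Ioc 0 1 ×ˢ univ)
  norm_eq_one : ∀ t ∈ Ioc (0 : ℝ) 1, ∀ x, ‖u t x‖ = 1
  eq_const : ∃ (uinf : Space) (R : ℝ), ∀ t ∈ Ioc (0 : ℝ) 1, ∀ x, R ≤ ‖x‖ → u t x = uinf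
  equation : ∀ t ∈ Ioc (0 : ℝ) 1, ∀ x,
    dtt u t x - Laplacian.laplacian (u t) x = (gradSq u t x - ‖dt u t x‖ ^ 2) • u t x

/-- The energy density `|∇u|²/2 + |∂ₜu|²/2`. -/
def energyDensity (u : ℝ → Plane → Space) (t : ℝ) (x : Plane) : ℝ :=
  gradSq u t x / 2 + ‖dt u t x‖ ^ 2 / 2

/-- The energy of `u` at time `t`. -/
def energy (u : ℝ → Plane → Space) (t : ℝ) : ℝ :=
  ∫ x, energyDensity u t x

/-- The outgoing flux density
`|∇u|²/2 + |∂ₜu|²/2 + (x/|x|) · ∇u† ∂ₜu`. -/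
def fluxDensity (u : ℝ → Plane → Space) (t : ℝ) (x : Plane) : ℝ :=
  energyDensity u t x + inner ℝ (dx u t x (‖x‖⁻¹ • x)) (dt u t x)

/-- The energy flux `(1/√2) ∫_{t₁}^{t₂} ∫_{|x| = t} fluxDensity dσ dt` through the light cone;
the circle `|x| = t` is parametrized by the angle `θ`, with arc length `dσ = t dθ`. -/
def flux (u : ℝ → Plane → Space) (t₁ t₂ : ℝ) : ℝ :=
  (1 / √2) * ∫ t in t₁..t₂, ∫ θ in (0 : ℝ)..(2 * Real.pi),
    fluxDensity u t !₂[t * Real.cos θ, t * Real.sin θ] * t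

/-- The weight `ρ_a = ((t + a)² - |x|²)^{-1/2}`. -/
def rho (a t : ℝ) (x : Plane) : ℝ :=
  ((t + a) ^ 2 - ‖x‖ ^ 2) ^ (-(1 / 2) : ℝ)

/-- `X^α ∂_α u`, where `X = (t + a) ∂ₜ + x · ∇`. -/
def vectorFieldX (a : ℝ) (u : ℝ → Plane → Space) (t : ℝ) (x : Plane) : Space :=
  (t + a) • dt u t x + dx u t x x

end WaveMap

end

/-! Put `a = ε T`. The estimate is a weighted Morawetz identity for `X = (t + a) ∂ₜ + x · ∇`, the
dilation field about the shifted origin `(-a, 0)`. The nonlinearity is parallel to `u`, hence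
orthogonal to every `∂ᵢu`, so the stress-energy tensor is divergence free as for the linear wave
equation. Contracting it with `X` gives a current whose divergence is only a trace term, `(|∇u|² -
|∂ₜu|²)/2` (`divergence_current`). The weight `ρ_a` satisfies `ρ_a² ((t + a)² - |x|²) = 1` and its
gradient is `-ρ_a³` times the Minkowski dual of `X`. After multiplication by `ρ_a` the trace term
therefore cancels and exactly `ρ_a³ |X u|²` remains (`divergence_weight_current`).

Integration over the truncated cone `a ≤ t ≤ T`, `|x| < t` bounds the bulk and top terms by two
others (`integral_weight_current`). At the bottom, `ρ_a ≲ 1/a` and the current is at most `3 a`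
times the energy density, so conservation of energy gives `2 E` (`integral_initial_le`). On the
lateral boundary the current is at most `a + 2t` times the flux density, while `ρ_a = (a (a +
2t))^{-1/2}`. This costs a factor `√(3/ε)`, which the hypothesis `Flux < ε E` absorbs
(`integral_boundary_le`). At the top, the shift by `a` only adds a nonnegative term
(`integral_final_le`). -/

namespace WaveMap

/-! ### Polar coordinates and the divergence theorem on the disc -/

/-- The unit vector `(cos θ, sin θ)`. -/
noncomputable def unitVec (θ : ℝ) : Plane := !₂[Real.cos θ, Real.sin θ]

/-- The first standard basis vector of the plane. -/
noncomputable def e0 : Plane := EuclideanSpace.single 0 1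

/-- The second standard basis vector of the plane. -/
noncomputable def e1 : Plane := EuclideanSpace.single 1 1

theorem plane_eq (y : Plane) : y = y 0 • e0 + y 1 • e1 := by
  ext i; fin_cases i <;> simp [e0, e1]

theorem unitVec_eq (θ : ℝ) : unitVec θ = Real.cos θ • e0 + Real.sin θ • e1 := by
  ext i; fin_cases i <;> simp [e0, e1, unitVec]

theorem hasDerivAt_unitVec (θ : ℝ) :
    HasDerivAt unitVec (-Real.sin θ • e0 + Real.cos θ • e1) θ := by
  have : unitVec = fun θ => Real.cos θ • e0 + Real.sin θ • e1 := funext unitVec_eq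
  rw [this]
  exact ((Real.hasDerivAt_cos θ).smul_const e0).add ((Real.hasDerivAt_sin θ).smul_const e1)

@[fun_prop]
theorem continuous_unitVec : Continuous unitVec :=
  continuous_iff_continuousAt.2 fun θ => (hasDerivAt_unitVec θ).continuousAt

@[simp] theorem norm_unitVec (θ : ℝ) : ‖unitVec θ‖ = 1 := by
  simp [unitVec, EuclideanSpace.norm_eq]

theorem norm_smul_unitVec {r : ℝ} (hr : 0 ≤ r) (θ : ℝ) : ‖r • unitVec θ‖ = r := by
  rw [norm_smul, norm_unitVec, Real.norm_of_nonneg hr, mul_one]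

theorem integral_plane_eq_polar (f : Plane → ℝ) :
    ∫ x, f x = ∫ p in polarCoord.target, p.1 • f (p.1 • unitVec p.2) := by
  have h1 := ((EuclideanSpace.volume_preserving_symm_measurableEquiv_toLp (Fin 2)).symm.integral_comp
    (MeasurableEquiv.measurableEmbedding _) f)
  have h2 := (volume_preserving_finTwoArrow ℝ).symm.integral_comp
    (MeasurableEquiv.measurableEmbedding _) (fun y : Fin 2 → ℝ => f (WithLp.toLp 2 y))
  have h3 := integral_comp_polarCoord_symm (fun p : ℝ × ℝ => f !₂[p.1, p.2])
  have h4 : ∫ x, f x = ∫ p : ℝ × ℝ, f !₂[p.1, p.2] := by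
    rw [← h1]; exact h2.symm
  rw [h4, ← h3]
  congr 1
  ext p
  congr 2
  ext i; fin_cases i <;> simp [unitVec, polarCoord_symm_apply]

theorem setIntegral_ball_eq_polar {f : Plane → ℝ}
    (hf : ContinuousOn f (Metric.closedBall 0 1)) :
    ∫ x in Metric.ball 0 1, f x =
      ∫ r in (0 : ℝ)..1, ∫ θ in (-Real.pi)..Real.pi, r * f (r • unitVec θ) := by
  have hpi : -Real.pi ≤ Real.pi := by linarith [Real.pi_pos]
  have hset : polarCoord.target ∩ {p : ℝ × ℝ | p.1 • unitVec p.2 ∈ Metric.ball (0 : Plane) 1} =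
      Ioo 0 1 ×ˢ Ioo (-Real.pi) Real.pi := by
    ext p
    simp only [polarCoord_target, mem_inter_iff, mem_prod, mem_Ioi, mem_Ioo, mem_ofPred_eq,
      mem_ball_zero_iff]
    constructor
    · rintro ⟨⟨h, h'⟩, h2⟩
      rw [norm_smul_unitVec h.le] at h2
      exact ⟨⟨h, h2⟩, h'⟩
    · rintro ⟨⟨h, h2⟩, h'⟩
      rw [norm_smul_unitVec h.le]
      exact ⟨⟨h, h'⟩, h2⟩
  have hm : MeasurableSet {p : ℝ × ℝ | p.1 • unitVec p.2 ∈ Metric.ball (0 : Plane) 1} :=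
    (Metric.isOpen_ball.preimage (by fun_prop :
      Continuous fun p : ℝ × ℝ => p.1 • unitVec p.2)).measurableSet
  have hint : IntegrableOn (fun p : ℝ × ℝ => p.1 * f (p.1 • unitVec p.2))
      (Ioo 0 1 ×ˢ Ioo (-Real.pi) Real.pi) := by
    refine IntegrableOn.mono_set (ContinuousOn.integrableOn_compact
      (isCompact_Icc.prod (isCompact_Icc (a := -Real.pi) (b := Real.pi)) :
        IsCompact (Icc (0 : ℝ) 1 ×ˢ _)) ?_)
      (prod_mono Ioo_subset_Icc_self Ioo_subset_Icc_self)
    refine continuousOn_fst.mul (hf.comp (by fun_prop) ?_)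
    rintro p ⟨hp, -⟩
    rw [mem_closedBall_zero_iff, norm_smul_unitVec hp.1]
    exact hp.2
  rw [← integral_indicator Metric.isOpen_ball.measurableSet, integral_plane_eq_polar]
  have : ∀ p : ℝ × ℝ, p.1 • (Metric.ball (0 : Plane) 1).indicator f (p.1 • unitVec p.2) =
      {p : ℝ × ℝ | p.1 • unitVec p.2 ∈ Metric.ball (0 : Plane) 1}.indicator
        (fun p => p.1 * f (p.1 • unitVec p.2)) p := by
    intro p
    by_cases h : p.1 • unitVec p.2 ∈ Metric.ball (0 : Plane) 1
    · rw [indicator_of_mem h, indicator_of_mem (by exact h), smul_eq_mul]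
    · rw [indicator_of_notMem h, indicator_of_notMem (by exact h), smul_zero]
  simp_rw [this]
  rw [setIntegral_indicator hm, hset, Measure.volume_eq_prod, setIntegral_prod _ hint,
    intervalIntegral.integral_of_le zero_le_one, integral_Ioc_eq_integral_Ioo]
  refine setIntegral_congr_fun measurableSet_Ioo fun r _ => ?_
  rw [intervalIntegral.integral_of_le hpi, integral_Ioc_eq_integral_Ioo]

/-- Polar coordinates use angles in `(-π, π)`, the flux uses `(0, 2π)`; periodicity reconciles them.
-/
theorem integral_unitVec_period (g : Plane → ℝ → ℝ → ℝ) :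
    ∫ θ in (-Real.pi)..Real.pi, g (unitVec θ) (Real.cos θ) (Real.sin θ) =
      ∫ θ in (0 : ℝ)..(2 * Real.pi), g (unitVec θ) (Real.cos θ) (Real.sin θ) := by
  have hp : Function.Periodic (fun θ => g (unitVec θ) (Real.cos θ) (Real.sin θ))
      (2 * Real.pi) := by
    intro θ
    simp [unitVec]
  have := hp.intervalIntegral_add_eq (-Real.pi) 0
  rw [zero_add] at this
  rw [← this]
  congr 1
  ring

/-- The divergence theorem on the unit disc. -/
theorem setIntegral_ball_divergence {V W : Plane → ℝ} {V' W' : Plane → Plane →L[ℝ] ℝ}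
    (hV : ContinuousOn V (Metric.closedBall 0 1)) (hW : ContinuousOn W (Metric.closedBall 0 1))
    (hV' : ∀ y ∈ Metric.ball (0 : Plane) 1, HasFDerivAt V (V' y) y)
    (hW' : ∀ y ∈ Metric.ball (0 : Plane) 1, HasFDerivAt W (W' y) y)
    (hd : ContinuousOn (fun y => V' y e0 + W' y e1) (Metric.closedBall 0 1)) :
    ∫ y in Metric.ball (0 : Plane) 1, (V' y e0 + W' y e1) =
      ∫ θ in (0 : ℝ)..(2 * Real.pi),
        (V (unitVec θ) * Real.cos θ + W (unitVec θ) * Real.sin θ) := by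
  have hpi : -Real.pi ≤ Real.pi := by linarith [Real.pi_pos]
  rw [setIntegral_ball_eq_polar hd]
  have hmaps : ∀ p ∈ uIcc (0 : ℝ) 1 ×ˢ uIcc (-Real.pi) Real.pi,
      p.1 • unitVec p.2 ∈ Metric.closedBall (0 : Plane) 1 := by
    rintro p ⟨hp, -⟩
    rw [uIcc_of_le zero_le_one] at hp
    rw [mem_closedBall_zero_iff, norm_smul_unitVec hp.1]
    exact hp.2
  have hcont : Continuous fun p : ℝ × ℝ => p.1 • unitVec p.2 := by fun_prop
  have hVc := hV.comp hcont.continuousOn hmaps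
  have hWc := hW.comp hcont.continuousOn hmaps
  have hdc := hd.comp hcont.continuousOn hmaps
  set L : ℝ × ℝ → ℝ × ℝ →L[ℝ] Plane := fun p =>
    p.1 • (ContinuousLinearMap.snd ℝ ℝ ℝ).smulRight (-Real.sin p.2 • e0 + Real.cos p.2 • e1) +
      (ContinuousLinearMap.fst ℝ ℝ ℝ).smulRight (unitVec p.2) with hL
  have hpol : ∀ p : ℝ × ℝ, HasFDerivAt (fun p : ℝ × ℝ => p.1 • unitVec p.2) (L p) p := by
    intro p
    have h2 : HasFDerivAt (fun p : ℝ × ℝ => unitVec p.2) _ p :=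
      (hasDerivAt_unitVec p.2).hasFDerivAt.comp p hasFDerivAt_snd
    refine (hasFDerivAt_fst.smul h2).congr_fderiv ?_
    ext <;> simp [hL]
  have hcos : ∀ p : ℝ × ℝ, HasFDerivAt (fun p : ℝ × ℝ => Real.cos p.2) _ p := fun p =>
    (Real.hasDerivAt_cos p.2).hasFDerivAt.comp p hasFDerivAt_snd
  have hsin : ∀ p : ℝ × ℝ, HasFDerivAt (fun p : ℝ × ℝ => Real.sin p.2) _ p := fun p =>
    (Real.hasDerivAt_sin p.2).hasFDerivAt.comp p hasFDerivAt_snd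
  have hmem : ∀ p ∈ Ioo (min (0 : ℝ) 1) (max 0 1) ×ˢ
      Ioo (min (-Real.pi) Real.pi) (max (-Real.pi) Real.pi) \ (∅ : Set (ℝ × ℝ)),
      p.1 • unitVec p.2 ∈ Metric.ball (0 : Plane) 1 := by
    rintro p ⟨⟨hp, -⟩, -⟩
    rw [min_eq_left zero_le_one, max_eq_right zero_le_one] at hp
    rw [mem_ball_zero_iff, norm_smul_unitVec hp.1.le]
    exact hp.2
  -- The rectangle `[0,1] × [-π,π]` carries the field with components `r (V cos θ + W sin θ)` and `W
  -- cos θ - V sin θ`. Its divergence in `(r, θ)` is `r` times the Cartesian divergence of `(V, W)`.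
  have hf : ∀ p ∈ Ioo (min (0 : ℝ) 1) (max 0 1) ×ˢ
      Ioo (min (-Real.pi) Real.pi) (max (-Real.pi) Real.pi) \ (∅ : Set (ℝ × ℝ)), HasFDerivAt
      (fun p : ℝ × ℝ => p.1 * (V (p.1 • unitVec p.2) * Real.cos p.2 +
        W (p.1 • unitVec p.2) * Real.sin p.2)) _ p := fun p hp =>
    hasFDerivAt_fst.mul ((((hV' _ (hmem p hp)).comp p (hpol p)).mul (hcos p)).add
      (((hW' _ (hmem p hp)).comp p (hpol p)).mul (hsin p)))
  have hg : ∀ p ∈ Ioo (min (0 : ℝ) 1) (max 0 1) ×ˢ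
      Ioo (min (-Real.pi) Real.pi) (max (-Real.pi) Real.pi) \ (∅ : Set (ℝ × ℝ)), HasFDerivAt
      (fun p : ℝ × ℝ => W (p.1 • unitVec p.2) * Real.cos p.2 -
        V (p.1 • unitVec p.2) * Real.sin p.2) _ p := fun p hp =>
    (((hW' _ (hmem p hp)).comp p (hpol p)).mul (hcos p)).sub
      (((hV' _ (hmem p hp)).comp p (hpol p)).mul (hsin p))
  have hdiv := integral2_divergence_prod_of_hasFDerivAt_off_countable _ _ _ _
    0 (-Real.pi) 1 Real.pi ∅ countable_empty
    (by
      refine continuousOn_fst.mul ((hVc.mul ?_).add (hWc.mul ?_)) <;>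
        exact Continuous.continuousOn (by fun_prop))
    (by
      refine (hWc.mul ?_).sub (hVc.mul ?_) <;> exact Continuous.continuousOn (by fun_prop))
    hf hg
  have heq : ∀ (A B : Plane →L[ℝ] ℝ) (r c s : ℝ),
      r * (c * (A (c • e0 + s • e1)) + s * B (c • e0 + s • e1)) +
        (c * (B (r • (-s • e0 + c • e1))) - s * A (r • (-s • e0 + c • e1))) =
      (c ^ 2 + s ^ 2) * (r * (A e0 + B e1)) := by
    intro A B r c s
    simp only [map_add, map_smul, smul_eq_mul]
    ring
  have hfg : ∀ r θ : ℝ, _ = r * (V' (r • unitVec θ) e0 + W' (r • unitVec θ) e1) := fun r θ =>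
    (heq (V' (r • unitVec θ)) (W' (r • unitVec θ)) r (Real.cos θ) (Real.sin θ)).trans
      (by rw [Real.cos_sq_add_sin_sq, one_mul])
  simp only [hL, add_apply, sub_apply,
    smul_apply, ContinuousLinearMap.comp_apply,
    ContinuousLinearMap.smulRight_apply, ContinuousLinearMap.coe_fst',
    ContinuousLinearMap.coe_snd', smul_eq_mul, map_zero, zero_smul, smul_zero, mul_zero, zero_add,
    add_zero, one_smul, ContinuousLinearMap.toSpanSingleton_apply, zero_mul, one_mul, mul_one] at hdiv
  have hfg' : ∀ r θ : ℝ, r * (Real.cos θ * V' (r • unitVec θ) (unitVec θ) +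
        Real.sin θ * W' (r • unitVec θ) (unitVec θ)) +
      (V (r • unitVec θ) * Real.cos θ + W (r • unitVec θ) * Real.sin θ) +
      (W (r • unitVec θ) * -Real.sin θ +
        Real.cos θ * W' (r • unitVec θ) (r • (-Real.sin θ • e0 + Real.cos θ • e1)) -
      (V (r • unitVec θ) * Real.cos θ +
        Real.sin θ * V' (r • unitVec θ) (r • (-Real.sin θ • e0 + Real.cos θ • e1)))) =
      r * (V' (r • unitVec θ) e0 + W' (r • unitVec θ) e1) := by
    intro r θ
    rw [← hfg, ← unitVec_eq]
    ring
  simp only [hfg'] at hdiv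
  have hpi' : unitVec (-Real.pi) = unitVec Real.pi := by simp [unitVec]
  rw [hdiv]
  -- The sides `θ = ±π` cancel and the side `r = 0` vanishes through the factor `r`; only the unit
  -- circle is left.
  · simp only [hpi', Real.cos_neg, Real.sin_neg, Real.sin_pi, neg_zero, mul_zero, sub_self,
      zero_add, intervalIntegral.integral_zero, sub_zero]
    exact integral_unitVec_period (fun v c s => V v * c + W v * s)
  · exact ContinuousOn.integrableOn_compact (isCompact_uIcc.prod isCompact_uIcc)
      (continuousOn_fst.mul hdc)

/-! ### Transport on discs of moving radius -/

theorem setIntegral_ball_smul (f : Plane → ℝ) {r : ℝ} (hr : 0 < r) :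
    ∫ y in Metric.ball (0 : Plane) 1, r ^ 2 * f (r • y) = ∫ x in Metric.ball (0 : Plane) r, f x := by
  rw [integral_const_mul, Measure.setIntegral_comp_smul _ _ _ hr.ne', smul_unitBall hr.ne',
    Real.norm_of_nonneg hr.le, finrank_euclideanSpace_fin, abs_of_pos (by positivity), smul_eq_mul]
  field_simp

/-- Stated for a general second factor because it serves both discs in the plane and intervals of
angles. -/
theorem integrable_prod_of_continuousOn {X : Type*} [TopologicalSpace X] [MeasurableSpace X]
    [OpensMeasurableSpace X] [T2Space X] [SecondCountableTopology X] (μ : Measure X)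
    [IsFiniteMeasureOnCompacts μ] [SFinite μ]
    {f : ℝ × X → ℝ} {t₁ t₂ : ℝ} {s k : Set X} (hk : IsCompact k) (hs : s ⊆ k)
    (hf : ContinuousOn f (Icc t₁ t₂ ×ˢ k)) :
    Integrable f ((volume.restrict (Ioc t₁ t₂)).prod (μ.restrict s)) := by
  have : IntegrableOn f (Icc t₁ t₂ ×ˢ k) (volume.prod μ) := by
    have : IntegrableOn f (Icc t₁ t₂ ×ˢ k)
      ((volume.restrict (Icc t₁ t₂)).prod (μ.restrict k)) := by
      have : IsFiniteMeasure (μ.restrict k) := ⟨by simpa using hk.measure_lt_top⟩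
      exact hf.integrableOn_compact (isCompact_Icc.prod hk)
    rw [Measure.prod_restrict, IntegrableOn, Measure.restrict_restrict_of_subset subset_rfl] at this
    exact this
  rw [Measure.prod_restrict]
  exact this.mono_set (prod_mono Ioc_subset_Icc_self hs)

/-- The transport theorem on a disc whose radius `b + c t` is affine in time. -/
theorem transport_of_hasFDerivAt {t₁ t₂ b c : ℝ} (h12 : t₁ ≤ t₂)
    (hr : ∀ t ∈ Icc t₁ t₂, 0 < b + c * t)
    {F G₀ G₁ Q : ℝ × Plane → ℝ} {F' G₀' G₁' : ℝ × Plane → ℝ × Plane →L[ℝ] ℝ} {K : Set (ℝ × Plane)}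
    (hK : ∀ t ∈ Icc t₁ t₂, ∀ x : Plane, ‖x‖ ≤ b + c * t → (t, x) ∈ K)
    (hF : ContinuousOn F K) (hG₀ : ContinuousOn G₀ K) (hG₁ : ContinuousOn G₁ K)
    (hQ : ContinuousOn Q K)
    (hF' : ContinuousOn F' K) (hG₀' : ContinuousOn G₀' K) (hG₁' : ContinuousOn G₁' K)
    (dF : ∀ p ∈ K, p.1 ∈ Ioo t₁ t₂ → HasFDerivAt F (F' p) p)
    (dG₀ : ∀ p ∈ K, p.1 ∈ Ioo t₁ t₂ → HasFDerivAt G₀ (G₀' p) p)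
    (dG₁ : ∀ p ∈ K, p.1 ∈ Ioo t₁ t₂ → HasFDerivAt G₁ (G₁' p) p)
    (heq : ∀ p ∈ K, p.1 ∈ Ioo t₁ t₂ → F' p (1, 0) = G₀' p (0, e0) + G₁' p (0, e1) - Q p) :
    (∫ x in Metric.ball (0 : Plane) (b + c * t₂), F (t₂, x)) -
      (∫ x in Metric.ball (0 : Plane) (b + c * t₁), F (t₁, x)) =
    (∫ t in t₁..t₂, ∫ θ in (0 : ℝ)..(2 * Real.pi), (b + c * t) *
      (c * F (t, (b + c * t) • unitVec θ) + (G₀ (t, (b + c * t) • unitVec θ) * Real.cos θ +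
        G₁ (t, (b + c * t) • unitVec θ) * Real.sin θ))) -
    ∫ t in t₁..t₂, ∫ x in Metric.ball (0 : Plane) (b + c * t), Q (t, x) := by
  set r : ℝ → ℝ := fun t => b + c * t with hrdef
  have hrc : Continuous r := by fun_prop
  set m : ℝ × Plane → ℝ × Plane := fun p => (p.1, r p.1 • p.2) with hm
  have hmc : Continuous m := by fun_prop
  have hmK : MapsTo m (Icc t₁ t₂ ×ˢ Metric.closedBall 0 1) K := by
    rintro ⟨t, y⟩ ⟨ht, hy⟩
    refine hK t ht _ ?_
    rw [norm_smul, Real.norm_of_nonneg (hr t ht).le]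
    exact mul_le_of_le_one_right (hr t ht).le (mem_closedBall_zero_iff.1 hy)
  have hFm := hF.comp hmc.continuousOn hmK
  have hQm := hQ.comp hmc.continuousOn hmK
  have hG₀m := hG₀.comp hmc.continuousOn hmK
  have hG₁m := hG₁.comp hmc.continuousOn hmK
  have hF'm := hF'.comp hmc.continuousOn hmK
  have hG₀'m := hG₀'.comp hmc.continuousOn hmK
  have hG₁'m := hG₁'.comp hmc.continuousOn hmK
  -- After the change of variables `x = r(t) y` the disc is fixed; `dH` is the time derivative of
  -- the pulled-back density `r² F(t, r y)`.
  set dH : ℝ × Plane → ℝ := fun p =>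
    2 * r p.1 * c * F (m p) + r p.1 ^ 2 * F' (m p) (1, c • p.2) with hdH
  have hdHc : ContinuousOn dH (Icc t₁ t₂ ×ˢ Metric.closedBall 0 1) := by
    refine ContinuousOn.add (ContinuousOn.mul ?_ hFm)
      (ContinuousOn.mul ?_ (hF'm.clm_apply ?_)) <;> exact Continuous.continuousOn (by fun_prop)
  set B : ℝ → ℝ := fun t => ∫ θ in (0 : ℝ)..(2 * Real.pi), r t *
      (c * F (t, r t • unitVec θ) + (G₀ (t, r t • unitVec θ) * Real.cos θ +
        G₁ (t, r t • unitVec θ) * Real.sin θ)) with hB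
  have hslice : ∀ t ∈ Icc t₁ t₂, MapsTo (fun y : Plane => (t, y)) (Metric.closedBall 0 1)
      (Icc t₁ t₂ ×ˢ Metric.closedBall 0 1) := fun t ht y hy => ⟨ht, hy⟩
  -- the fundamental theorem of calculus along rays
  have stepA : ∀ y ∈ Metric.ball (0 : Plane) 1,
      ∫ t in t₁..t₂, dH (t, y) = r t₂ ^ 2 * F (t₂, r t₂ • y) - r t₁ ^ 2 * F (t₁, r t₁ • y) := by
    intro y hy
    have hy' := Metric.ball_subset_closedBall hy
    have hmap : MapsTo (fun t : ℝ => (t, y)) (Icc t₁ t₂)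
        (Icc t₁ t₂ ×ˢ Metric.closedBall 0 1) := fun t ht => ⟨ht, hy'⟩
    refine intervalIntegral.integral_eq_sub_of_hasDerivAt_of_le
      (f := fun t => r t ^ 2 * F (t, r t • y)) h12 ?_ ?_ ?_
    · exact (hrc.pow 2).continuousOn.mul
        (hFm.comp (Continuous.continuousOn (by fun_prop)) hmap)
    · intro t ht
      have hd : HasDerivAt r c t := by
        simpa only [mul_one] using ((hasDerivAt_id' t).const_mul c).const_add b
      have hmd : HasDerivAt (fun t : ℝ => (t, r t • y)) ((1 : ℝ), c • y) t :=
        (hasDerivAt_id t).prodMk (hd.smul_const y)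
      have hFd := (dF (m (t, y)) (hmK (hmap (Ioo_subset_Icc_self ht))) ht).comp_hasDerivAt t hmd
      refine ((hd.pow 2).mul hFd).congr_deriv ?_
      simp [hdH, hm]
    · refine ContinuousOn.intervalIntegrable ?_
      rw [uIcc_of_le h12]
      exact hdHc.comp (Continuous.continuousOn (by fun_prop)) hmap
  -- the divergence theorem at fixed time
  have stepC : ∀ t ∈ Ioo t₁ t₂, ∫ y in Metric.ball (0 : Plane) 1, dH (t, y) =
      B t - ∫ x in Metric.ball (0 : Plane) (r t), Q (t, x) := by
    intro t ht
    have htI := Ioo_subset_Icc_self ht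
    have hs := hslice t htI
    have hcs : ContinuousOn (fun y : Plane => (t, y)) (Metric.closedBall 0 1) :=
      Continuous.continuousOn (by fun_prop)
    have hin : ∀ y ∈ Metric.ball (0 : Plane) 1, m (t, y) ∈ K := fun y hy =>
      hmK (hs (Metric.ball_subset_closedBall hy))
    have hmd : ∀ y : Plane, HasFDerivAt (fun y => m (t, y))
        ((ContinuousLinearMap.inr ℝ ℝ Plane).comp (r t • ContinuousLinearMap.id ℝ Plane)) y := by
      intro y
      refine ((hasFDerivAt_const t y).prodMk ((hasFDerivAt_id y).const_smul (r t))).congr_fderiv ?_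
      ext <;> simp
    have hy : ∀ (i : Fin 2) (y : Plane), HasFDerivAt (fun y : Plane => y i)
        (EuclideanSpace.proj i : Plane →L[ℝ] ℝ) y := fun i y =>
      (EuclideanSpace.proj i : Plane →L[ℝ] ℝ).hasFDerivAt
    -- The field `r (c F y + G)` on the unit disc has divergence `dH + r² Q`: the term `c F y`
    -- accounts for the motion of the boundary, `G` for the current.
    have hVd : ∀ (i : Fin 2) (G : ℝ × Plane → ℝ) (G' : ℝ × Plane → ℝ × Plane →L[ℝ] ℝ),
        (∀ p ∈ K, p.1 ∈ Ioo t₁ t₂ → HasFDerivAt G (G' p) p) → ∀ y ∈ Metric.ball (0 : Plane) 1,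
        HasFDerivAt (fun y : Plane => r t * (c * (F (m (t, y)) * y i) + G (m (t, y))))
          (r t • (c • (F (m (t, y)) • (EuclideanSpace.proj i : Plane →L[ℝ] ℝ) +
            y i • (F' (m (t, y))).comp ((ContinuousLinearMap.inr ℝ ℝ Plane).comp
              (r t • ContinuousLinearMap.id ℝ Plane))) +
            (G' (m (t, y))).comp ((ContinuousLinearMap.inr ℝ ℝ Plane).comp
              (r t • ContinuousLinearMap.id ℝ Plane)))) y := by
      intro i G G' hG y hyb
      exact (((((dF _ (hin y hyb) ht).comp y (hmd y)).mul (hy i y)).const_mul c).add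
        ((hG _ (hin y hyb) ht).comp y (hmd y))).const_mul (r t)
    have hVc : ∀ (i : Fin 2) (G : ℝ × Plane → ℝ),
        ContinuousOn (G ∘ m) (Icc t₁ t₂ ×ˢ Metric.closedBall 0 1) →
        ContinuousOn (fun y : Plane => r t * (c * (F (m (t, y)) * y i) + G (m (t, y))))
          (Metric.closedBall 0 1) := by
      intro i G hG
      exact continuousOn_const.mul ((continuousOn_const.mul ((hFm.comp hcs hs).mul
        (Continuous.continuousOn (by fun_prop)))).add (hG.comp hcs hs))
    have hG'c : ∀ (v : Plane) (G' : ℝ × Plane → ℝ × Plane →L[ℝ] ℝ),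
        ContinuousOn (G' ∘ m) (Icc t₁ t₂ ×ˢ Metric.closedBall 0 1) →
        ContinuousOn (fun y : Plane => G' (m (t, y)) (0, v)) (Metric.closedBall 0 1) :=
      fun v G' hG' => (hG'.comp hcs hs).clm_apply continuousOn_const
    have hcoord : ∀ i : Fin 2, ContinuousOn (fun y : Plane => y i) (Metric.closedBall 0 1) :=
      fun i => Continuous.continuousOn (by fun_prop)
    have hproj : ∀ (i : Fin 2) (v : Plane), (EuclideanSpace.proj i : Plane →L[ℝ] ℝ) v = v i :=
      fun _ _ => rfl
    have hVW := setIntegral_ball_divergence (hVc 0 G₀ hG₀m) (hVc 1 G₁ hG₁m) (hVd 0 G₀ G₀' dG₀)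
      (hVd 1 G₁ G₁' dG₁)
    simp only [add_apply, smul_apply, ContinuousLinearMap.comp_apply,
      ContinuousLinearMap.inr_apply, ContinuousLinearMap.id_apply, hproj,
      smul_eq_mul, map_smul] at hVW
    have hcont : ContinuousOn (fun y : Plane => r t * (c * (F (m (t, y)) * e0 0 +
        y 0 * (r t * F' (m (t, y)) (0, e0))) + r t * G₀' (m (t, y)) (0, e0)) +
        r t * (c * (F (m (t, y)) * e1 1 + y 1 * (r t * F' (m (t, y)) (0, e1))) +
          r t * G₁' (m (t, y)) (0, e1))) (Metric.closedBall 0 1) :=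
      (continuousOn_const.mul ((continuousOn_const.mul (((hFm.comp hcs hs).mul
        continuousOn_const).add ((hcoord 0).mul (continuousOn_const.mul (hG'c e0 F' hF'm))))).add
          (continuousOn_const.mul (hG'c e0 G₀' hG₀'m)))).add
      (continuousOn_const.mul ((continuousOn_const.mul (((hFm.comp hcs hs).mul
        continuousOn_const).add ((hcoord 1).mul (continuousOn_const.mul (hG'c e1 F' hF'm))))).add
          (continuousOn_const.mul (hG'c e1 G₁' hG₁'m))))
    have hVW' := hVW hcont
    have hpt : ∀ y ∈ Metric.ball (0 : Plane) 1, dH (t, y) =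
        (r t * (c * (F (m (t, y)) * e0 0 +
        y 0 * (r t * F' (m (t, y)) (0, e0))) + r t * G₀' (m (t, y)) (0, e0)) +
        r t * (c * (F (m (t, y)) * e1 1 + y 1 * (r t * F' (m (t, y)) (0, e1))) +
          r t * G₁' (m (t, y)) (0, e1))) - r t ^ 2 * Q (t, r t • y) := by
      intro y hyb
      have h10 : ((1 : ℝ), c • y) = (1, 0) + (c * y 0) • ((0 : ℝ), e0) +
          (c * y 1) • ((0 : ℝ), e1) := by
        ext i
        · simp
        · fin_cases i <;> simp [e0, e1]
      have he0 : e0 0 = 1 := by simp [e0]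
      have he1 : e1 1 = 1 := by simp [e1]
      have hE := heq _ (hin y hyb) ht
      simp only [hdH]
      rw [h10, map_add, map_add, map_smul, map_smul, hE, he0, he1]
      simp only [hm, smul_eq_mul]
      ring
    rw [setIntegral_congr_fun Metric.isOpen_ball.measurableSet hpt, integral_sub, hVW',
      setIntegral_ball_smul (fun x => Q (t, x)) (hr t htI : 0 < r t)]
    · simp only [hB, hm]
      congr 1
      refine intervalIntegral.integral_congr fun θ _ => ?_
      have h0 : unitVec θ 0 = Real.cos θ := by simp [unitVec]
      have h1 : unitVec θ 1 = Real.sin θ := by simp [unitVec]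
      simp only [h0, h1]
      linear_combination r t * c * F (t, r t • unitVec θ) * Real.cos_sq_add_sin_sq θ
    · exact (ContinuousOn.integrableOn_compact (isCompact_closedBall (0 : Plane) 1)
        hcont).mono_set Metric.ball_subset_closedBall
    · exact (ContinuousOn.integrableOn_compact (isCompact_closedBall (0 : Plane) 1)
        (continuousOn_const.mul (hQm.comp hcs hs))).mono_set Metric.ball_subset_closedBall
  have stepB : ∫ y in Metric.ball (0 : Plane) 1, ∫ t in t₁..t₂, dH (t, y) =
      ∫ t in t₁..t₂, ∫ y in Metric.ball (0 : Plane) 1, dH (t, y) := by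
    simp only [intervalIntegral.integral_of_le h12]
    exact (integral_integral_swap (f := fun t y => dH (t, y)) (integrable_prod_of_continuousOn volume
      (isCompact_closedBall (0 : Plane) 1) Metric.ball_subset_closedBall hdHc)).symm
  have hint : ∀ t ∈ Icc t₁ t₂, IntegrableOn (fun y : Plane => r t ^ 2 * F (t, r t • y))
      (Metric.ball 0 1) := by
    intro t ht
    refine (ContinuousOn.integrableOn_compact (isCompact_closedBall (0 : Plane) 1)
      ?_).mono_set Metric.ball_subset_closedBall
    exact continuousOn_const.mul (hFm.comp (Continuous.continuousOn (by fun_prop)) (hslice t ht))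
  have h1 := left_mem_Icc.2 h12
  have h2 := right_mem_Icc.2 h12
  have hBint : IntervalIntegrable B volume t₁ t₂ := by
    have hmap : MapsTo (fun p : ℝ × ℝ => (p.1, unitVec p.2)) (Icc t₁ t₂ ×ˢ Icc 0 (2 * Real.pi))
        (Icc t₁ t₂ ×ˢ Metric.closedBall 0 1) := fun p hp => ⟨hp.1, by simp⟩
    have hc : Continuous fun p : ℝ × ℝ => (p.1, unitVec p.2) := by fun_prop
    have := (integrable_prod_of_continuousOn (t₁ := t₁) (t₂ := t₂) (volume : Measure ℝ)
      (isCompact_Icc (a := (0 : ℝ)) (b := 2 * Real.pi)) Ioc_subset_Icc_self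
      (f := fun p => r p.1 * (c * F (m (p.1, unitVec p.2)) +
        (G₀ (m (p.1, unitVec p.2)) * Real.cos p.2 + G₁ (m (p.1, unitVec p.2)) * Real.sin p.2))) (by
        refine ContinuousOn.mul ?_ ((continuousOn_const.mul
          (hFm.comp hc.continuousOn hmap)).add
          (((hG₀m.comp hc.continuousOn hmap).mul ?_).add
            ((hG₁m.comp hc.continuousOn hmap).mul ?_))) <;>
          exact Continuous.continuousOn (by fun_prop))).integral_prod_left
    rw [intervalIntegrable_iff_integrableOn_Ioc_of_le h12]
    simp only [hB, intervalIntegral.integral_of_le Real.two_pi_pos.le]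
    exact this
  have hQint : IntervalIntegrable (fun t => ∫ x in Metric.ball (0 : Plane) (r t), Q (t, x))
      volume t₁ t₂ := by
    have := (integrable_prod_of_continuousOn (t₁ := t₁) (t₂ := t₂) (volume : Measure Plane)
      (isCompact_closedBall (0 : Plane) 1) Metric.ball_subset_closedBall
      (f := fun p => r p.1 ^ 2 * Q (m p))
      ((Continuous.continuousOn (by fun_prop)).mul hQm)).integral_prod_left
    rw [intervalIntegrable_iff_integrableOn_Ioc_of_le h12]
    refine IntegrableOn.congr_fun this (fun t ht => ?_) measurableSet_Ioc
    exact setIntegral_ball_smul (fun x => Q (t, x)) (hr t (Ioc_subset_Icc_self ht))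
  rw [← setIntegral_ball_smul _ (hr t₂ h2), ← setIntegral_ball_smul _ (hr t₁ h1),
    ← integral_sub (hint t₂ h2) (hint t₁ h1),
    ← setIntegral_congr_fun Metric.isOpen_ball.measurableSet stepA, stepB,
    ← intervalIntegral.integral_sub hBint hQint, intervalIntegral.integral_of_le h12,
    intervalIntegral.integral_of_le h12, integral_Ioc_eq_integral_Ioo,
    integral_Ioc_eq_integral_Ioo]
  exact setIntegral_congr_fun measurableSet_Ioo stepC

/-! ### Derivatives on the slab and the wave map equation -/

/-- The space-time slab `(0,1] × ℝ²`. -/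
def slab : Set (ℝ × Plane) := Ioc 0 1 ×ˢ univ

/-- The coordinate vectors of space-time; time comes first. -/
noncomputable def coordVec : Fin 3 → ℝ × Plane := ![(1, 0), (0, e0), (0, e1)]

/-- The derivatives `∂ᵢ u` as functions on space-time. -/
noncomputable def pd (u : ℝ → Plane → Space) (i : Fin 3) (p : ℝ × Plane) : Space :=
  fderivWithin ℝ (fun p : ℝ × Plane => u p.1 p.2) slab p (coordVec i)

theorem uniqueDiffOn_slab : UniqueDiffOn ℝ slab :=
  (uniqueDiffOn_Ioc 0 1).prod uniqueDiffOn_univ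

theorem slab_mem_nhds {p : ℝ × Plane} (hp : p.1 ∈ Ioo (0 : ℝ) 1) : slab ∈ nhds p :=
  prod_mem_nhds (Ioc_mem_nhds hp.1 hp.2) Filter.univ_mem

section slices

variable {E : Type*} [NormedAddCommGroup E] [NormedSpace ℝ E] {f : ℝ × Plane → E}

/-- Expresses time derivatives, one-sided at `t = 1`, through a single space-time derivative, so
that smoothness and symmetry of second derivatives become available. -/
theorem derivWithin_slice (hf : DifferentiableOn ℝ f slab) {t : ℝ} (ht : t ∈ Ioc (0 : ℝ) 1)
    (x : Plane) :
    derivWithin (fun s => f (s, x)) (Ioc 0 1) t = fderivWithin ℝ f slab (t, x) (1, 0) := by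
  have h1 := (hf (t, x) ⟨ht, mem_univ _⟩).hasFDerivWithinAt
  have h2 : HasDerivWithinAt (fun s : ℝ => (s, x)) ((1 : ℝ), (0 : Plane)) (Ioc 0 1) t :=
    (hasDerivWithinAt_id t _).prodMk (hasDerivWithinAt_const t _ x)
  have hm : MapsTo (fun s : ℝ => (s, x)) (Ioc 0 1) slab := fun s hs => ⟨hs, mem_univ _⟩
  exact (h1.comp_hasDerivWithinAt t h2 hm).derivWithin (uniqueDiffOn_Ioc 0 1 t ht)

theorem hasFDerivAt_slice (hf : DifferentiableOn ℝ f slab) {t : ℝ} (ht : t ∈ Ioc (0 : ℝ) 1)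
    (x : Plane) : HasFDerivAt (fun y => f (t, y))
      ((fderivWithin ℝ f slab (t, x)).comp (ContinuousLinearMap.inr ℝ ℝ Plane)) x := by
  have h1 := (hf (t, x) ⟨ht, mem_univ _⟩).hasFDerivWithinAt
  have h2 : HasFDerivWithinAt (fun y : Plane => (t, y)) (ContinuousLinearMap.inr ℝ ℝ Plane)
      univ x := (hasFDerivAt_prodMk_right t x).hasFDerivWithinAt
  exact hasFDerivWithinAt_univ.1 (h1.comp x h2 fun s hs => ⟨ht, mem_univ _⟩)

theorem fderiv_slice (hf : DifferentiableOn ℝ f slab) {t : ℝ} (ht : t ∈ Ioc (0 : ℝ) 1)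
    (x y : Plane) :
    fderiv ℝ (fun y => f (t, y)) x y = fderivWithin ℝ f slab (t, x) (0, y) := by
  rw [(hasFDerivAt_slice hf ht x).fderiv]; simp

end slices

namespace IsClassical

variable {u : ℝ → Plane → Space}

theorem contDiffOn_pd (hu : IsClassical u) (i : Fin 3) : ContDiffOn ℝ ∞ (pd u i) slab :=
  (hu.smooth.fderivWithin uniqueDiffOn_slab (m := ∞) (by simp)).clm_apply contDiffOn_const

theorem differentiableOn (hu : IsClassical u) :
    DifferentiableOn ℝ (fun p : ℝ × Plane => u p.1 p.2) slab :=
  hu.smooth.differentiableOn (by simp)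

theorem differentiableOn_pd (hu : IsClassical u) (i : Fin 3) :
    DifferentiableOn ℝ (pd u i) slab := (hu.contDiffOn_pd i).differentiableOn (by simp)

theorem dt_eq (hu : IsClassical u) {t : ℝ} (ht : t ∈ Ioc (0 : ℝ) 1) (x : Plane) :
    dt u t x = pd u 0 (t, x) :=
  derivWithin_slice hu.differentiableOn ht x

theorem dx_eq_fderivWithin (hu : IsClassical u) {t : ℝ} (ht : t ∈ Ioc (0 : ℝ) 1) (x y : Plane) :
    dx u t x y = fderivWithin ℝ (fun p : ℝ × Plane => u p.1 p.2) slab (t, x) (0, y) :=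
  fderiv_slice hu.differentiableOn ht x y

theorem dx_eq (hu : IsClassical u) {t : ℝ} (ht : t ∈ Ioc (0 : ℝ) 1) (x y : Plane) :
    dx u t x y = y 0 • pd u 1 (t, x) + y 1 • pd u 2 (t, x) := by
  have : ((0 : ℝ), y) = y 0 • coordVec 1 + y 1 • coordVec 2 := by
    conv_lhs => rw [plane_eq y]
    ext <;> simp [coordVec]
  rw [hu.dx_eq_fderivWithin ht, this, map_add, map_smul, map_smul]
  rfl

theorem dtt_eq (hu : IsClassical u) {t : ℝ} (ht : t ∈ Ioc (0 : ℝ) 1) (x : Plane) :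
    dtt u t x = fderivWithin ℝ (pd u 0) slab (t, x) (coordVec 0) := by
  rw [dtt, derivWithin_congr (fun s hs => hu.dt_eq hs x) (hu.dt_eq ht x)]
  exact derivWithin_slice (hu.differentiableOn_pd 0) ht x

theorem laplacian_eq (hu : IsClassical u) {t : ℝ} (ht : t ∈ Ioc (0 : ℝ) 1) (x : Plane) :
    Laplacian.laplacian (u t) x = fderivWithin ℝ (pd u 1) slab (t, x) (coordVec 1) +
      fderivWithin ℝ (pd u 2) slab (t, x) (coordVec 2) := by
  have hsm : ContDiff ℝ ∞ (u t) := by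
    refine contDiffOn_univ.1 (hu.smooth.comp (g := fun p : ℝ × Plane => u p.1 p.2)
      (f := fun y : Plane => (t, y)) (contDiff_prodMk_right t).contDiffOn
      fun y _ => ⟨ht, mem_univ _⟩)
  have hd : Differentiable ℝ (fderiv ℝ (u t)) :=
    (hsm.fderiv_right (m := 1) (by norm_cast)).differentiable (by simp)
  have h2 : ∀ (v : Plane) (i : Fin 3), coordVec i = (0, v) →
      fderiv ℝ (fderiv ℝ (u t)) x v v = fderivWithin ℝ (pd u i) slab (t, x) (coordVec i) := by
    intro v i hi
    have h3 : (fun y => fderiv ℝ (u t) y v) = fun y => pd u i (t, y) := by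
      ext1 y
      rw [pd, hi]
      exact hu.dx_eq_fderivWithin ht y v
    have h4 : fderiv ℝ (fun y => fderiv ℝ (u t) y v) x v = fderiv ℝ (fderiv ℝ (u t)) x v v := by
      rw [((hd x).hasFDerivAt.clm_apply (hasFDerivAt_const v x)).fderiv]
      simp
    rw [← h4, h3, fderiv_slice (hu.differentiableOn_pd i) ht, hi]
  rw [InnerProductSpace.laplacian_eq_iteratedFDeriv_orthonormalBasis _
    (EuclideanSpace.basisFun (Fin 2) ℝ)]
  simp only [iteratedFDeriv_two_apply, Fin.sum_univ_two, EuclideanSpace.basisFun_apply,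
    Matrix.cons_val_zero, Matrix.cons_val_one]
  exact congrArg₂ _ (h2 e0 1 rfl) (h2 e1 2 rfl)

theorem gradSq_eq (hu : IsClassical u) {t : ℝ} (ht : t ∈ Ioc (0 : ℝ) 1) (x : Plane) :
    gradSq u t x = ‖pd u 1 (t, x)‖ ^ 2 + ‖pd u 2 (t, x)‖ ^ 2 := by
  simp [gradSq, hu.dx_eq ht]

/-- Differentiate `|u|² = 1`. -/
theorem inner_pd (hu : IsClassical u) {p : ℝ × Plane} (hp : p.1 ∈ Ioo (0 : ℝ) 1) (i : Fin 3) :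
    inner ℝ (u p.1 p.2) (pd u i p) = 0 := by
  have hd := (hu.differentiableOn p
    ⟨Ioo_subset_Ioc_self hp, mem_univ _⟩).hasFDerivWithinAt.hasFDerivAt (slab_mem_nhds hp)
  have h1 := (hd.inner ℝ hd)
  have h2 : (fun p : ℝ × Plane => inner ℝ (u p.1 p.2) (u p.1 p.2)) =ᶠ[nhds p] fun _ => (1 : ℝ) := by
    filter_upwards [slab_mem_nhds hp] with q hq
    rw [real_inner_self_eq_norm_sq, hu.norm_eq_one q.1 hq.1, one_pow]
  have h3 := congrArg (fun L : ℝ × Plane →L[ℝ] ℝ => L (coordVec i))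
    ((h2.hasFDerivAt_iff.1 h1).unique (hasFDerivAt_const 1 p))
  simp only [ContinuousLinearMap.comp_apply, ContinuousLinearMap.prod_apply,
    fderivInnerCLM_apply, zero_apply] at h3
  have h4 := real_inner_comm (u p.1 p.2)
    (fderivWithin ℝ (fun p : ℝ × Plane => u p.1 p.2) slab p (coordVec i))
  rw [pd]
  linarith

theorem hasFDerivAt_pd (hu : IsClassical u) {p : ℝ × Plane} (hp : p.1 ∈ Ioo (0 : ℝ) 1)
    (i : Fin 3) : HasFDerivAt (pd u i) (fderiv ℝ (pd u i) p) p :=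
  (((hu.differentiableOn_pd i) p ⟨Ioo_subset_Ioc_self hp, mem_univ _⟩).differentiableAt
    (slab_mem_nhds hp)).hasFDerivAt

theorem fderiv_pd_symm (hu : IsClassical u) {p : ℝ × Plane} (hp : p.1 ∈ Ioo (0 : ℝ) 1)
    (i j : Fin 3) : fderiv ℝ (pd u i) p (coordVec j) = fderiv ℝ (pd u j) p (coordVec i) := by
  set U : ℝ × Plane → Space := fun p => u p.1 p.2
  have hU : ContDiffAt ℝ ∞ U p :=
    hu.smooth.contDiffAt (slab_mem_nhds hp)
  have hopen : ∀ᶠ q : ℝ × Plane in nhds p, q.1 ∈ Ioo (0 : ℝ) 1 :=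
    (isOpen_Ioo.preimage continuous_fst).mem_nhds hp
  have hd : DifferentiableAt ℝ (fderiv ℝ U) p :=
    (hU.fderiv_right (m := 1) (by norm_cast)).differentiableAt (by simp)
  have h : ∀ i j : Fin 3, fderiv ℝ (pd u i) p (coordVec j) =
      fderiv ℝ (fderiv ℝ U) p (coordVec j) (coordVec i) := by
    intro i j
    have h1 : pd u i =ᶠ[nhds p] fun q => fderiv ℝ U q (coordVec i) := by
      filter_upwards [hopen] with q hq
      rw [pd, fderivWithin_of_mem_nhds (slab_mem_nhds hq)]
    rw [h1.fderiv_eq, (hd.hasFDerivAt.clm_apply (hasFDerivAt_const (coordVec i) p)).fderiv]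
    simp
  have h2 : minSmoothness ℝ 2 ≤ (∞ : WithTop ℕ∞) := by
    simpa using (WithTop.coe_le_coe.2 le_top : ((2 : ℕ∞) : WithTop ℕ∞) ≤ ∞)
  rw [h, h, (hU.isSymmSndFDerivAt h2).eq]

/-- The right side of the equation is a multiple of `u`, hence orthogonal to `∂ᵢu`. This is the only
way in which the equation enters the estimate. -/
theorem inner_box_pd (hu : IsClassical u) {p : ℝ × Plane} (hp : p.1 ∈ Ioo (0 : ℝ) 1)
    (i : Fin 3) :
    inner ℝ (fderiv ℝ (pd u 0) p (coordVec 0)) (pd u i p) =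
      inner ℝ (fderiv ℝ (pd u 1) p (coordVec 1)) (pd u i p) +
      inner ℝ (fderiv ℝ (pd u 2) p (coordVec 2)) (pd u i p) := by
  have ht := Ioo_subset_Ioc_self hp
  have heq := hu.equation p.1 ht p.2
  rw [hu.dtt_eq ht, hu.laplacian_eq ht, fderivWithin_of_mem_nhds (slab_mem_nhds hp),
    fderivWithin_of_mem_nhds (slab_mem_nhds hp), fderivWithin_of_mem_nhds (slab_mem_nhds hp)] at heq
  have h := congrArg (fun v => inner ℝ v (pd u i p)) heq
  simp only [inner_sub_left, inner_add_left, inner_smul_left, hu.inner_pd hp, mul_zero] at h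
  linarith

end IsClassical

/-! ### The stress-energy current and the weight -/

/-- The inner products `∂ᵢu · ∂ⱼu`. -/
noncomputable def gram (u : ℝ → Plane → Space) (i j : Fin 3) (p : ℝ × Plane) : ℝ :=
  inner ℝ (pd u i p) (pd u j p)

/-- The energy density in terms of the inner products `∂ᵢu · ∂ⱼu`. -/
noncomputable def gramEnergy (u : ℝ → Plane → Space) (p : ℝ × Plane) : ℝ :=
  (gram u 0 0 p + gram u 1 1 p + gram u 2 2 p) / 2

/-- The time component of the contraction of the stress-energy tensor with `X`. -/
noncomputable def currentTime (a : ℝ) (u : ℝ → Plane → Space) (p : ℝ × Plane) : ℝ :=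
  (p.1 + a) * gramEnergy u p + (p.2 0 * gram u 0 1 p + p.2 1 * gram u 0 2 p)

/-- The spatial components of the contraction of the stress-energy tensor with `X`; the vector
`∂ⱼu` is `pd u i` and the coordinate `xⱼ` is `z`. -/
noncomputable def currentSpace (a : ℝ) (u : ℝ → Plane → Space) (i : Fin 3) (j : Fin 2)
    (p : ℝ × Plane) : ℝ :=
  (p.1 + a) * gram u 0 i p + (p.2 0 * gram u 1 i p + p.2 1 * gram u 2 i p) -
    p.2 j * (gram u 1 1 p + gram u 2 2 p - gram u 0 0 p) / 2

/-- The square of `X u`. -/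
noncomputable def gramX (a : ℝ) (u : ℝ → Plane → Space) (p : ℝ × Plane) : ℝ :=
  ‖(p.1 + a) • pd u 0 p + (p.2 0 • pd u 1 p + p.2 1 • pd u 2 p)‖ ^ 2

/-- The weight `ρ_a` as a function on space-time. -/
noncomputable def weight (a : ℝ) (p : ℝ × Plane) : ℝ := rho a p.1 p.2

theorem norm_sq_plane (x : Plane) : ‖x‖ ^ 2 = x 0 ^ 2 + x 1 ^ 2 := by
  simp [EuclideanSpace.norm_sq_eq]

theorem gramX_eq (a : ℝ) (u : ℝ → Plane → Space) (p : ℝ × Plane) :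
    gramX a u p = (p.1 + a) ^ 2 * gram u 0 0 p + p.2 0 ^ 2 * gram u 1 1 p +
      p.2 1 ^ 2 * gram u 2 2 p + 2 * (p.1 + a) * (p.2 0 * gram u 0 1 p + p.2 1 * gram u 0 2 p) +
      2 * p.2 0 * p.2 1 * gram u 1 2 p := by
  rw [gramX, ← real_inner_self_eq_norm_sq]
  simp only [gram, inner_add_left, inner_add_right, inner_smul_left, inner_smul_right,
    conj_trivial, real_inner_comm (pd u 0 p), real_inner_comm (pd u 1 p) (pd u 2 p)]
  ring

theorem gram_comm (u : ℝ → Plane → Space) (i j : Fin 3) : gram u i j = gram u j i :=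
  funext fun _ => real_inner_comm _ _

/-- The open set `|x| < t + a` on which the weight is smooth. -/
def shiftedCone (a : ℝ) : Set (ℝ × Plane) := {p | ‖p.2‖ < p.1 + a}

theorem isOpen_shiftedCone (a : ℝ) : IsOpen (shiftedCone a) :=
  isOpen_lt (by fun_prop) (by fun_prop)

theorem base_pos {a : ℝ} {p : ℝ × Plane} (hp : p ∈ shiftedCone a) :
    0 < (p.1 + a) ^ 2 - ‖p.2‖ ^ 2 := by
  have : ‖p.2‖ < p.1 + a := hp
  nlinarith [norm_nonneg p.2]

theorem weight_sq {a : ℝ} {p : ℝ × Plane} (hp : p ∈ shiftedCone a) :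
    weight a p ^ 2 * ((p.1 + a) ^ 2 - ‖p.2‖ ^ 2) = 1 := by
  have h := base_pos hp
  rw [weight, rho, ← Real.rpow_natCast, ← Real.rpow_mul h.le]
  norm_num
  rw [Real.rpow_neg_one]
  exact inv_mul_cancel₀ h.ne'

theorem weight_pos {a : ℝ} {p : ℝ × Plane} (hp : p ∈ shiftedCone a) : 0 < weight a p :=
  Real.rpow_pos_of_pos (base_pos hp) _

theorem contDiffOn_weight (a : ℝ) : ContDiffOn ℝ ∞ (weight a) (shiftedCone a) := by
  have h : ContDiffOn ℝ ∞ (fun p : ℝ × Plane => (p.1 + a) ^ 2 - ‖p.2‖ ^ 2) (shiftedCone a) :=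
    ContDiff.contDiffOn (((contDiff_fst.add contDiff_const).pow 2).sub (contDiff_snd.norm_sq ℝ))
  exact h.rpow_const_of_ne fun p hp => (base_pos hp).ne'

/-- The gradient of `ρ_a` is `-ρ_a³` times the Minkowski dual of `X`, which is why differentiating
the weight produces the square of `X u`. -/
theorem fderiv_weight {a : ℝ} {p : ℝ × Plane} (hp : p ∈ shiftedCone a) (v : ℝ × Plane) :
    fderiv ℝ (weight a) p v =
      - weight a p ^ 3 * ((p.1 + a) * v.1 - (p.2 0 * v.2 0 + p.2 1 * v.2 1)) := by
  have h := base_pos hp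
  have h1 : HasFDerivAt (fun p : ℝ × Plane => (p.1 + a) ^ 2 - ‖p.2‖ ^ 2) _ p :=
    ((hasFDerivAt_fst.add_const a).pow 2).sub hasFDerivAt_snd.norm_sq
  have h2 : HasFDerivAt (weight a) _ p := h1.rpow_const (p := -(1 / 2)) (Or.inl h.ne')
  have h3 : weight a p ^ 3 = ((p.1 + a) ^ 2 - ‖p.2‖ ^ 2) ^ (-(1 / 2) - 1 : ℝ) := by
    rw [weight, rho, ← Real.rpow_natCast, ← Real.rpow_mul h.le]
    norm_num
  rw [h2.fderiv, h3]
  have h4 : inner ℝ p.2 v.2 = p.2 0 * v.2 0 + p.2 1 * v.2 1 := by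
    rw [PiLp.inner_apply, Fin.sum_univ_two]
    simp [mul_comm]
  simp [h4]
  ring

/-! ### Divergence identities -/

namespace IsClassical

variable {u : ℝ → Plane → Space}

theorem contDiffOn_gram (hu : IsClassical u) (i j : Fin 3) :
    ContDiffOn ℝ ∞ (gram u i j) slab :=
  (hu.contDiffOn_pd i).inner ℝ (hu.contDiffOn_pd j)

theorem contDiffOn_gramEnergy (hu : IsClassical u) : ContDiffOn ℝ ∞ (gramEnergy u) slab :=
  (((hu.contDiffOn_gram 0 0).add (hu.contDiffOn_gram 1 1)).add (hu.contDiffOn_gram 2 2)).div_const 2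

theorem contDiffOn_coord (i : Fin 2) (s : Set (ℝ × Plane)) :
    ContDiffOn ℝ ∞ (fun p : ℝ × Plane => p.2 i) s :=
  ((EuclideanSpace.proj i : Plane →L[ℝ] ℝ).contDiff.comp contDiff_snd).contDiffOn

theorem contDiffOn_time (a : ℝ) (s : Set (ℝ × Plane)) :
    ContDiffOn ℝ ∞ (fun p : ℝ × Plane => p.1 + a) s :=
  (contDiff_fst.add contDiff_const).contDiffOn

theorem contDiffOn_currentTime (hu : IsClassical u) (a : ℝ) :
    ContDiffOn ℝ ∞ (currentTime a u) slab :=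
  ((contDiffOn_time a _).mul hu.contDiffOn_gramEnergy).add
    (((contDiffOn_coord 0 _).mul (hu.contDiffOn_gram 0 1)).add
      ((contDiffOn_coord 1 _).mul (hu.contDiffOn_gram 0 2)))

theorem contDiffOn_currentSpace (hu : IsClassical u) (a : ℝ) (i : Fin 3) (j : Fin 2) :
    ContDiffOn ℝ ∞ (currentSpace a u i j) slab :=
  (((contDiffOn_time a _).mul (hu.contDiffOn_gram 0 i)).add
    (((contDiffOn_coord 0 _).mul (hu.contDiffOn_gram 1 i)).add
      ((contDiffOn_coord 1 _).mul (hu.contDiffOn_gram 2 i)))).sub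
  (((contDiffOn_coord j _).mul (((hu.contDiffOn_gram 1 1).add (hu.contDiffOn_gram 2 2)).sub
    (hu.contDiffOn_gram 0 0))).div_const 2)

theorem contDiffOn_gramX (hu : IsClassical u) (a : ℝ) : ContDiffOn ℝ ∞ (gramX a u) slab :=
  (((contDiffOn_time a _).smul (hu.contDiffOn_pd 0)).add
    (((contDiffOn_coord 0 _).smul (hu.contDiffOn_pd 1)).add
      ((contDiffOn_coord 1 _).smul (hu.contDiffOn_pd 2)))).norm_sq ℝ

theorem hasFDerivAt_of_contDiffOn_slab {f : ℝ × Plane → ℝ} (hf : ContDiffOn ℝ ∞ f slab)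
    {p : ℝ × Plane} (hp : p.1 ∈ Ioo (0 : ℝ) 1) : HasFDerivAt f (fderiv ℝ f p) p :=
  ((hf.contDiffAt (slab_mem_nhds hp)).differentiableAt (by simp)).hasFDerivAt

theorem fderiv_gram (hu : IsClassical u) {p : ℝ × Plane} (hp : p.1 ∈ Ioo (0 : ℝ) 1)
    (i j : Fin 3) (v : ℝ × Plane) : fderiv ℝ (gram u i j) p v =
      inner ℝ (fderiv ℝ (pd u i) p v) (pd u j p) + inner ℝ (fderiv ℝ (pd u j) p v) (pd u i p) := by
  have h : HasFDerivAt (gram u i j) _ p := (hu.hasFDerivAt_pd hp i).inner ℝ (hu.hasFDerivAt_pd hp j)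
  rw [h.fderiv, real_inner_comm (pd u i p)]
  simp [add_comm]

theorem fderiv_gramEnergy (hu : IsClassical u) {p : ℝ × Plane} (hp : p.1 ∈ Ioo (0 : ℝ) 1)
    (v : ℝ × Plane) : fderiv ℝ (gramEnergy u) p v =
      (fderiv ℝ (gram u 0 0) p v + fderiv ℝ (gram u 1 1) p v + fderiv ℝ (gram u 2 2) p v) / 2 := by
  have hg := fun i j => hasFDerivAt_of_contDiffOn_slab (hu.contDiffOn_gram i j) hp
  have h : HasFDerivAt (gramEnergy u) _ p :=
    (((hg 0 0).add (hg 1 1)).add (hg 2 2)).mul_const (2⁻¹ : ℝ)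
  rw [h.fderiv]
  simp
  ring

/-- Local conservation of energy. -/
theorem fderiv_gramEnergy_time (hu : IsClassical u) {p : ℝ × Plane} (hp : p.1 ∈ Ioo (0 : ℝ) 1) :
    fderiv ℝ (gramEnergy u) p (coordVec 0) =
      fderiv ℝ (gram u 0 1) p (coordVec 1) + fderiv ℝ (gram u 0 2) p (coordVec 2) := by
  rw [hu.fderiv_gramEnergy hp]
  simp only [hu.fderiv_gram hp]
  rw [hu.fderiv_pd_symm hp 1 0, hu.fderiv_pd_symm hp 2 0]
  linarith [hu.inner_box_pd hp 0]

theorem hasFDerivAt_coord (i : Fin 2) (p : ℝ × Plane) :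
    HasFDerivAt (fun p : ℝ × Plane => p.2 i)
      ((EuclideanSpace.proj i : Plane →L[ℝ] ℝ).comp (ContinuousLinearMap.snd ℝ ℝ Plane)) p :=
  ((EuclideanSpace.proj i : Plane →L[ℝ] ℝ).comp (ContinuousLinearMap.snd ℝ ℝ Plane)).hasFDerivAt

theorem fderiv_currentTime (hu : IsClassical u) (a : ℝ) {p : ℝ × Plane}
    (hp : p.1 ∈ Ioo (0 : ℝ) 1) (v : ℝ × Plane) : fderiv ℝ (currentTime a u) p v =
      v.1 * gramEnergy u p + (p.1 + a) * fderiv ℝ (gramEnergy u) p v +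
      (v.2 0 * gram u 0 1 p + p.2 0 * fderiv ℝ (gram u 0 1) p v) +
      (v.2 1 * gram u 0 2 p + p.2 1 * fderiv ℝ (gram u 0 2) p v) := by
  have hg := fun i j => hasFDerivAt_of_contDiffOn_slab (hu.contDiffOn_gram i j) hp
  have he := hasFDerivAt_of_contDiffOn_slab hu.contDiffOn_gramEnergy hp
  have h : HasFDerivAt (currentTime a u) _ p := ((hasFDerivAt_fst.add_const a).mul he).add
    (((hasFDerivAt_coord 0 p).mul (hg 0 1)).add ((hasFDerivAt_coord 1 p).mul (hg 0 2)))
  rw [h.fderiv]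
  simp
  ring

theorem fderiv_currentSpace (hu : IsClassical u) (a : ℝ) {p : ℝ × Plane}
    (hp : p.1 ∈ Ioo (0 : ℝ) 1) (i : Fin 3) (j : Fin 2) (v : ℝ × Plane) :
    fderiv ℝ (currentSpace a u i j) p v =
      v.1 * gram u 0 i p + (p.1 + a) * fderiv ℝ (gram u 0 i) p v +
      (v.2 0 * gram u 1 i p + p.2 0 * fderiv ℝ (gram u 1 i) p v) +
      (v.2 1 * gram u 2 i p + p.2 1 * fderiv ℝ (gram u 2 i) p v) -
      (v.2 j * (gram u 1 1 p + gram u 2 2 p - gram u 0 0 p) + p.2 j *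
        (fderiv ℝ (gram u 1 1) p v + fderiv ℝ (gram u 2 2) p v - fderiv ℝ (gram u 0 0) p v)) / 2 := by
  have hg := fun i j => hasFDerivAt_of_contDiffOn_slab (hu.contDiffOn_gram i j) hp
  have h : HasFDerivAt (currentSpace a u i j) _ p :=
    (((hasFDerivAt_fst.add_const a).mul (hg 0 i)).add
      (((hasFDerivAt_coord 0 p).mul (hg 1 i)).add ((hasFDerivAt_coord 1 p).mul (hg 2 i)))).sub
    (((hasFDerivAt_coord j p).mul (((hg 1 1).add (hg 2 2)).sub (hg 0 0))).mul_const (2⁻¹ : ℝ))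
  rw [h.fderiv]
  simp
  ring

/-- The covariant derivative of the dilation field `X` is the identity, so the divergence of the
current is the trace of the stress-energy tensor. In dimension `2 + 1` this is half the Lagrangian
up to sign. -/
theorem divergence_current (hu : IsClassical u) (a : ℝ) {p : ℝ × Plane}
    (hp : p.1 ∈ Ioo (0 : ℝ) 1) :
    fderiv ℝ (currentTime a u) p (coordVec 0) =
      fderiv ℝ (currentSpace a u 1 0) p (coordVec 1) +
      fderiv ℝ (currentSpace a u 2 1) p (coordVec 2) +
      (gram u 1 1 p + gram u 2 2 p - gram u 0 0 p) / 2 := by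
  have h00 : (coordVec 0).1 = 1 := rfl
  have h0 : ∀ i, (coordVec 0).2 i = 0 := fun i => rfl
  have h10 : (coordVec 1).1 = 0 := rfl
  have h20 : (coordVec 2).1 = 0 := rfl
  have h11 : (coordVec 1).2 0 = 1 := by simp [coordVec, e0]
  have h12 : (coordVec 1).2 1 = 0 := by simp [coordVec, e0]
  have h21 : (coordVec 2).2 0 = 0 := by simp [coordVec, e1]
  have h22 : (coordVec 2).2 1 = 1 := by simp [coordVec, e1]
  rw [hu.fderiv_currentTime a hp, hu.fderiv_currentSpace a hp, hu.fderiv_currentSpace a hp,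
    hu.fderiv_gramEnergy_time hp, h00, h0, h0, h10, h20, h11, h12, h21, h22, gram_comm u 2 1]
  simp only [hu.fderiv_gram hp]
  rw [hu.fderiv_pd_symm hp 1 0, hu.fderiv_pd_symm hp 2 0, hu.fderiv_pd_symm hp 2 1, gramEnergy]
  -- Energy conservation has absorbed the time component of `X`; the spatial components pair the
  -- equation with `x₁ ∂₁u + x₂ ∂₂u`.
  linear_combination p.2 0 * hu.inner_box_pd hp 1 + p.2 1 * hu.inner_box_pd hp 2

/-- Contracting the stress-energy tensor with `X` and the gradient of `ρ_a` yields `ρ_a³ |X u|²` and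
a multiple of the Lagrangian with coefficient `ρ_a³ ((t + a)² - |x|²) = ρ_a`. The latter cancels the
trace term. -/
theorem divergence_weight_current (hu : IsClassical u) (a : ℝ) {p : ℝ × Plane}
    (hp : p.1 ∈ Ioo (0 : ℝ) 1) (hpa : p ∈ shiftedCone a) :
    fderiv ℝ (fun p => weight a p * currentTime a u p) p (coordVec 0) =
      fderiv ℝ (fun p => weight a p * currentSpace a u 1 0 p) p (coordVec 1) +
      fderiv ℝ (fun p => weight a p * currentSpace a u 2 1 p) p (coordVec 2) -
      weight a p ^ 3 * gramX a u p := by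
  have hw : HasFDerivAt (weight a) (fderiv ℝ (weight a) p) p :=
    (((contDiffOn_weight a).contDiffAt ((isOpen_shiftedCone a).mem_nhds hpa)).differentiableAt
      (by simp)).hasFDerivAt
  have h := fun f (hf : ContDiffOn ℝ ∞ f slab) =>
    (hw.mul (hasFDerivAt_of_contDiffOn_slab hf hp)).fderiv
  have h0 : fderiv ℝ (fun p => weight a p * currentTime a u p) p = _ :=
    h _ (hu.contDiffOn_currentTime a)
  have h1 : fderiv ℝ (fun p => weight a p * currentSpace a u 1 0 p) p = _ :=
    h _ (hu.contDiffOn_currentSpace a 1 0)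
  have h2 : fderiv ℝ (fun p => weight a p * currentSpace a u 2 1 p) p = _ :=
    h _ (hu.contDiffOn_currentSpace a 2 1)
  have hsq := weight_sq hpa
  rw [norm_sq_plane] at hsq
  rw [h0, h1, h2, gramX_eq]
  simp only [add_apply, smul_apply, smul_eq_mul, fderiv_weight hpa, hu.divergence_current a hp]
  simp only [coordVec, e0, e1, Matrix.cons_val_zero, Matrix.cons_val_one, Matrix.cons_val,
    currentTime, currentSpace, gramEnergy, gram_comm u 2 1]
  simp
  linear_combination (-weight a p * (gram u 1 1 p + gram u 2 2 p - gram u 0 0 p) / 2) * hsq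

end IsClassical

/-! ### Transport on the slab and integrals over angles -/

/-- The transport theorem for smooth densities and currents on a relatively open part of the
slab. -/
theorem transport {t₁ t₂ b c : ℝ} (h12 : t₁ ≤ t₂) (ht₁ : 0 < t₁) (ht₂ : t₂ ≤ 1)
    (hr : ∀ t ∈ Icc t₁ t₂, 0 < b + c * t) {O : Set (ℝ × Plane)} (hO : IsOpen O)
    (hsub : ∀ t ∈ Icc t₁ t₂, ∀ x : Plane, ‖x‖ ≤ b + c * t → (t, x) ∈ O)
    {F G₀ G₁ Q : ℝ × Plane → ℝ} (hF : ContDiffOn ℝ ∞ F (slab ∩ O))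
    (hG₀ : ContDiffOn ℝ ∞ G₀ (slab ∩ O)) (hG₁ : ContDiffOn ℝ ∞ G₁ (slab ∩ O))
    (hQ : ContinuousOn Q (slab ∩ O))
    (heq : ∀ p : ℝ × Plane, p.1 ∈ Ioo (0 : ℝ) 1 → p ∈ O → fderiv ℝ F p (coordVec 0) =
      fderiv ℝ G₀ p (coordVec 1) + fderiv ℝ G₁ p (coordVec 2) - Q p) :
    (∫ x in Metric.ball (0 : Plane) (b + c * t₂), F (t₂, x)) -
      (∫ x in Metric.ball (0 : Plane) (b + c * t₁), F (t₁, x)) =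
    (∫ t in t₁..t₂, ∫ θ in (0 : ℝ)..(2 * Real.pi), (b + c * t) *
      (c * F (t, (b + c * t) • unitVec θ) + (G₀ (t, (b + c * t) • unitVec θ) * Real.cos θ +
        G₁ (t, (b + c * t) • unitVec θ) * Real.sin θ))) -
    ∫ t in t₁..t₂, ∫ x in Metric.ball (0 : Plane) (b + c * t), Q (t, x) := by
  have hu : UniqueDiffOn ℝ (slab ∩ O) := uniqueDiffOn_slab.inter hO
  have hIoo : ∀ {t : ℝ}, t ∈ Ioo t₁ t₂ → t ∈ Ioo (0 : ℝ) 1 := fun h =>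
    ⟨ht₁.trans h.1, h.2.trans_le ht₂⟩
  have hn : ∀ p ∈ slab ∩ O, p.1 ∈ Ioo t₁ t₂ → slab ∩ O ∈ nhds p := fun p hp h =>
    Filter.inter_mem (slab_mem_nhds (hIoo h)) (hO.mem_nhds hp.2)
  have hc : ∀ {f : ℝ × Plane → ℝ}, ContDiffOn ℝ ∞ f (slab ∩ O) →
      ContinuousOn (fderivWithin ℝ f (slab ∩ O)) (slab ∩ O) := fun hf =>
    hf.continuousOn_fderivWithin hu (by simp)
  have hd : ∀ {f : ℝ × Plane → ℝ}, ContDiffOn ℝ ∞ f (slab ∩ O) → ∀ p ∈ slab ∩ O,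
      p.1 ∈ Ioo t₁ t₂ → HasFDerivAt f (fderivWithin ℝ f (slab ∩ O) p) p := fun hf p hp h =>
    ((hf.differentiableOn (by simp) p hp).hasFDerivWithinAt).hasFDerivAt (hn p hp h)
  refine transport_of_hasFDerivAt h12 hr (K := slab ∩ O)
    (fun t ht x hx => ⟨⟨⟨ht₁.trans_le ht.1, ht.2.trans ht₂⟩, mem_univ _⟩, hsub t ht x hx⟩)
    hF.continuousOn hG₀.continuousOn hG₁.continuousOn hQ (hc hF) (hc hG₀) (hc hG₁)
    (hd hF) (hd hG₀) (hd hG₁) fun p hp h => ?_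
  simp only [fderivWithin_of_mem_nhds (hn p hp h)]
  exact heq p (hIoo h) hp.2

theorem intervalIntegrable_integral_angle {g : ℝ × ℝ → ℝ} {t₁ t₂ : ℝ} (h12 : t₁ ≤ t₂)
    (hg : ContinuousOn g (Icc t₁ t₂ ×ˢ univ)) :
    IntervalIntegrable (fun t => ∫ θ in (0 : ℝ)..(2 * Real.pi), g (t, θ)) volume t₁ t₂ := by
  rw [intervalIntegrable_iff_integrableOn_Ioc_of_le h12]
  simp only [intervalIntegral.integral_of_le Real.two_pi_pos.le]
  exact (integrable_prod_of_continuousOn (volume : Measure ℝ)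
    (isCompact_Icc (a := (0 : ℝ)) (b := 2 * Real.pi)) Ioc_subset_Icc_self
    (hg.mono (prod_mono subset_rfl (subset_univ _)))).integral_prod_left

theorem integral_angle_mono {g h : ℝ × ℝ → ℝ} {t₁ t₂ : ℝ} (h12 : t₁ ≤ t₂)
    (hg : ContinuousOn g (Icc t₁ t₂ ×ˢ univ)) (hh : ContinuousOn h (Icc t₁ t₂ ×ˢ univ))
    (hgh : ∀ t ∈ Icc t₁ t₂, ∀ θ, g (t, θ) ≤ h (t, θ)) :
    ∫ t in t₁..t₂, ∫ θ in (0 : ℝ)..(2 * Real.pi), g (t, θ) ≤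
      ∫ t in t₁..t₂, ∫ θ in (0 : ℝ)..(2 * Real.pi), h (t, θ) := by
  have hs : ∀ t ∈ Icc t₁ t₂, ∀ k : ℝ × ℝ → ℝ, ContinuousOn k (Icc t₁ t₂ ×ˢ univ) →
      IntervalIntegrable (fun θ => k (t, θ)) volume 0 (2 * Real.pi) := by
    intro t ht k hk
    have : Continuous fun θ => k (t, θ) := by
      rw [← continuousOn_univ]
      exact hk.comp (Continuous.continuousOn (by fun_prop)) fun θ _ => ⟨ht, mem_univ _⟩
    exact this.intervalIntegrable _ _
  exact intervalIntegral.integral_mono_on h12 (intervalIntegrable_integral_angle h12 hg)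
    (intervalIntegrable_integral_angle h12 hh) fun t ht =>
      intervalIntegral.integral_mono_on Real.two_pi_pos.le (hs t ht g hg) (hs t ht h hh)
        fun θ _ => hgh t ht θ

/-! ### Pointwise bounds for energy and flux densities -/

theorem gramEnergy_eq (u : ℝ → Plane → Space) (p : ℝ × Plane) :
    gramEnergy u p = (‖pd u 0 p‖ ^ 2 + ‖pd u 1 p‖ ^ 2 + ‖pd u 2 p‖ ^ 2) / 2 := by
  simp only [gramEnergy, gram, real_inner_self_eq_norm_sq]

theorem gramEnergy_nonneg (u : ℝ → Plane → Space) (p : ℝ × Plane) : 0 ≤ gramEnergy u p := by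
  rw [gramEnergy_eq]; positivity

/-- Multiplied by `2|x|`, the difference of the two sides is the sum of the squares of `|x| ∂ₜu - x
· ∇u` and of the rotational derivative. -/
theorem inner_radial_le (u : ℝ → Plane → Space) (p : ℝ × Plane) (x : Plane) :
    x 0 * gram u 0 1 p + x 1 * gram u 0 2 p ≤ ‖x‖ * gramEnergy u p := by
  have hx := norm_sq_plane x
  have h1 : 0 ≤ ‖‖x‖ • pd u 0 p - (x 0 • pd u 1 p + x 1 • pd u 2 p)‖ ^ 2 := by positivity
  have h2 : 0 ≤ ‖x 1 • pd u 1 p - x 0 • pd u 2 p‖ ^ 2 := by positivity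
  rw [← real_inner_self_eq_norm_sq] at h1 h2
  simp only [inner_sub_left, inner_sub_right, inner_add_left, inner_add_right, inner_smul_left,
    inner_smul_right, conj_trivial, real_inner_comm (pd u 0 p),
    real_inner_comm (pd u 1 p) (pd u 2 p)] at h1 h2
  have key : ‖x‖ * (x 0 * gram u 0 1 p + x 1 * gram u 0 2 p) ≤ ‖x‖ * (‖x‖ * gramEnergy u p) := by
    have : ‖x‖ * (‖x‖ * gramEnergy u p) = ‖x‖ ^ 2 * gram u 0 0 p / 2 +
        (x 0 ^ 2 + x 1 ^ 2) * (gram u 1 1 p + gram u 2 2 p) / 2 := by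
      rw [← hx, gramEnergy]; ring
    rw [this]
    simp only [gram]
    nlinarith
  rcases (norm_nonneg x).eq_or_lt with h | h
  · have : x = 0 := norm_eq_zero.1 h.symm
    simp [this]
  · exact le_of_mul_le_mul_left key h

/-- The flux density `e + ∂ᵣu · ∂ₜu` in the direction `unitVec θ`. -/
noncomputable def gramFlux (u : ℝ → Plane → Space) (θ : ℝ) (p : ℝ × Plane) : ℝ :=
  gramEnergy u p + (gram u 0 1 p * Real.cos θ + gram u 0 2 p * Real.sin θ)

/-- The flux controls exactly the derivatives tangential to the cone: the outgoing null derivative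
and the angular one. In particular it is nonnegative. -/
theorem two_mul_gramFlux (u : ℝ → Plane → Space) (θ : ℝ) (p : ℝ × Plane) :
    2 * gramFlux u θ p =
      ‖pd u 0 p + (Real.cos θ • pd u 1 p + Real.sin θ • pd u 2 p)‖ ^ 2 +
      ‖Real.sin θ • pd u 1 p - Real.cos θ • pd u 2 p‖ ^ 2 := by
  rw [← real_inner_self_eq_norm_sq, ← real_inner_self_eq_norm_sq]
  simp only [inner_sub_left, inner_sub_right, inner_add_left, inner_add_right, inner_smul_left,
    inner_smul_right, conj_trivial, real_inner_comm (pd u 0 p),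
    real_inner_comm (pd u 1 p) (pd u 2 p), gramFlux, gramEnergy, gram]
  linear_combination -(inner ℝ (pd u 1 p) (pd u 1 p) + inner ℝ (pd u 2 p) (pd u 2 p)) *
    Real.cos_sq_add_sin_sq θ

theorem gramFlux_nonneg (u : ℝ → Plane → Space) (θ : ℝ) (p : ℝ × Plane) :
    0 ≤ gramFlux u θ p := by
  have h := two_mul_gramFlux u θ p
  have : 0 ≤ 2 * gramFlux u θ p := by rw [h]; positivity
  linarith

/-- The flux of the current through the light cone. -/
theorem current_flux_le (u : ℝ → Plane → Space) (a : ℝ) {t : ℝ} (ht : 0 ≤ t) (θ : ℝ) :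
    currentTime a u (t, t • unitVec θ) +
      (currentSpace a u 1 0 (t, t • unitVec θ) * Real.cos θ +
        currentSpace a u 2 1 (t, t • unitVec θ) * Real.sin θ) ≤
      (a + 2 * t) * gramFlux u θ (t, t • unitVec θ) := by
  set p : ℝ × Plane := (t, t • unitVec θ) with hp
  -- The two sides differ by exactly this quantity, `t` times the squared angular derivative.
  have h : 0 ≤ t * ‖Real.sin θ • pd u 1 p - Real.cos θ • pd u 2 p‖ ^ 2 := by positivity
  rw [← real_inner_self_eq_norm_sq] at h
  simp only [inner_sub_left, inner_sub_right, inner_smul_left,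
    inner_smul_right, conj_trivial, real_inner_comm (pd u 1 p) (pd u 2 p)] at h
  have h1 : p.1 = t := rfl
  have h2 : p.2 0 = t * Real.cos θ := by simp [hp, unitVec]
  have h3 : p.2 1 = t * Real.sin θ := by simp [hp, unitVec]
  simp only [currentTime, currentSpace, gramFlux, gramEnergy, gram_comm u 2 1, h1, h2, h3]
  simp only [gram]
  have hcs := Real.cos_sq_add_sin_sq θ
  refine le_of_sub_nonneg (h.trans_eq ?_)
  linear_combination (t * (inner ℝ (pd u 1 p) (pd u 1 p) / 2 +
    inner ℝ (pd u 2 p) (pd u 2 p) / 2 + inner ℝ (pd u 0 p) (pd u 0 p) / 2)) * hcs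

/-! ### Compact support and conservation of energy -/

namespace IsClassical

variable {u : ℝ → Plane → Space}

theorem energyDensity_eq (hu : IsClassical u) {t : ℝ} (ht : t ∈ Ioc (0 : ℝ) 1) (x : Plane) :
    energyDensity u t x = gramEnergy u (t, x) := by
  rw [energyDensity, hu.gradSq_eq ht, hu.dt_eq ht, gramEnergy_eq]
  ring

theorem pd_eq_zero (hu : IsClassical u) : ∃ R : ℝ, 0 < R ∧ ∀ t ∈ Ioc (0 : ℝ) 1, ∀ x : Plane,
    R ≤ ‖x‖ → ∀ i, pd u i (t, x) = 0 := by
  obtain ⟨v, R, hR⟩ := hu.eq_const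
  refine ⟨max R 0 + 1, by positivity, fun t ht x hx i => ?_⟩
  have hRx : R < ‖x‖ := by linarith [le_max_left R 0]
  have h : (fun p : ℝ × Plane => u p.1 p.2) =ᶠ[nhdsWithin (t, x) slab] fun _ => v := by
    have ho : ∀ᶠ p : ℝ × Plane in nhdsWithin (t, x) slab, R < ‖p.2‖ :=
      nhdsWithin_le_nhds ((isOpen_lt continuous_const (by fun_prop)).mem_nhds hRx)
    filter_upwards [ho, self_mem_nhdsWithin] with p hp hps
    exact hR p.1 hps.1 p.2 hp.le
  rw [pd, h.fderivWithin_eq (hR t ht x hRx.le), fderivWithin_const_apply]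
  simp

theorem exists_energy_eq (hu : IsClassical u) : ∃ R : ℝ, 0 < R ∧
    (∀ t ∈ Ioc (0 : ℝ) 1, ∀ x : Plane, R ≤ ‖x‖ → ∀ i, pd u i (t, x) = 0) ∧
    ∀ t ∈ Ioc (0 : ℝ) 1, energy u t = ∫ x in Metric.ball (0 : Plane) R, gramEnergy u (t, x) := by
  obtain ⟨R, hR, h⟩ := hu.pd_eq_zero
  refine ⟨R, hR, h, fun t ht => ?_⟩
  rw [energy, setIntegral_eq_integral_of_forall_compl_eq_zero]
  · exact integral_congr_ae (Filter.Eventually.of_forall (hu.energyDensity_eq ht))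
  · intro x hx
    have hx' : R ≤ ‖x‖ := by simpa using hx
    simp [gramEnergy_eq, h t ht x hx']

/-- Transport on a cylinder of fixed radius `R` (`c = 0`), on whose boundary all derivatives of `u`
vanish. -/
theorem energy_eq_of_le (hu : IsClassical u) {t₁ t₂ : ℝ} (ht₁ : t₁ ∈ Ioc (0 : ℝ) 1)
    (ht₂ : t₂ ∈ Ioc (0 : ℝ) 1) (h12 : t₁ ≤ t₂) : energy u t₂ = energy u t₁ := by
  obtain ⟨R, hR, h0, hE⟩ := hu.exists_energy_eq
  have h := transport (b := R) (c := 0) (Q := 0) h12 ht₁.1 ht₂.2 (by simp [hR]) isOpen_univ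
    (by simp) (hu.contDiffOn_gramEnergy.mono inter_subset_left)
    ((hu.contDiffOn_gram 0 1).mono inter_subset_left)
    ((hu.contDiffOn_gram 0 2).mono inter_subset_left) continuousOn_const
    (fun p hp _ => by rw [hu.fderiv_gramEnergy_time hp]; simp)
  have hz : ∀ t ∈ uIcc t₁ t₂, (∫ θ in (0 : ℝ)..(2 * Real.pi), (R + 0 * t) *
      (0 * gramEnergy u (t, (R + 0 * t) • unitVec θ) +
        (gram u 0 1 (t, (R + 0 * t) • unitVec θ) * Real.cos θ +
        gram u 0 2 (t, (R + 0 * t) • unitVec θ) * Real.sin θ))) = 0 := by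
    intro t ht
    rw [uIcc_of_le h12] at ht
    have : ∀ θ i, pd u i (t, R • unitVec θ) = 0 := fun θ i =>
      h0 t ⟨ht₁.1.trans_le ht.1, ht.2.trans ht₂.2⟩ _ (norm_smul_unitVec hR.le θ).ge i
    simp [gram, this]
  rw [intervalIntegral.integral_congr hz] at h
  simp only [zero_mul, add_zero, Pi.zero_apply, integral_zero, intervalIntegral.integral_zero,
    sub_zero] at h
  rw [hE t₁ ht₁, hE t₂ ht₂]
  linarith

theorem energy_eq (hu : IsClassical u) {t₁ t₂ : ℝ} (ht₁ : t₁ ∈ Ioc (0 : ℝ) 1)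
    (ht₂ : t₂ ∈ Ioc (0 : ℝ) 1) : energy u t₁ = energy u t₂ := by
  rcases le_total t₁ t₂ with h | h
  · exact (hu.energy_eq_of_le ht₁ ht₂ h).symm
  · exact hu.energy_eq_of_le ht₂ ht₁ h

theorem continuous_gramEnergy (hu : IsClassical u) {t : ℝ} (ht : t ∈ Ioc (0 : ℝ) 1) :
    Continuous fun x => gramEnergy u (t, x) := by
  rw [← continuousOn_univ]
  exact hu.contDiffOn_gramEnergy.continuousOn.comp (Continuous.continuousOn (by fun_prop))
    fun x _ => ⟨ht, mem_univ _⟩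

theorem setIntegral_gramEnergy_le (hu : IsClassical u) {t : ℝ} (ht : t ∈ Ioc (0 : ℝ) 1) (r : ℝ) :
    ∫ x in Metric.ball (0 : Plane) r, gramEnergy u (t, x) ≤ energy u t := by
  obtain ⟨R, hR, h0⟩ := hu.pd_eq_zero
  have hi : Integrable fun x => gramEnergy u (t, x) := by
    rw [← integrableOn_iff_integrable_of_support_subset (s := Metric.closedBall 0 R)]
    · exact (hu.continuous_gramEnergy ht).continuousOn.integrableOn_compact
        (isCompact_closedBall _ _)
    · intro x hx
      rw [mem_closedBall_zero_iff]
      by_contra! hlt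
      exact hx (by simp [gramEnergy_eq, h0 t ht x hlt.le])
  refine (setIntegral_le_integral hi (Filter.Eventually.of_forall fun x =>
    gramEnergy_nonneg u _)).trans_eq ?_
  exact integral_congr_ae (Filter.Eventually.of_forall fun x => (hu.energyDensity_eq ht x).symm)

end IsClassical

/-! ### The flux through the light cone -/

/-- The point of the light cone at time `t` and angle `θ`, where `q = (t, θ)`. -/
noncomputable def conePoint (q : ℝ × ℝ) : ℝ × Plane := (q.1, q.1 • unitVec q.2)

theorem continuousOn_comp_conePoint {f : ℝ × Plane → ℝ} {t₁ t₂ : ℝ} {s : Set (ℝ × Plane)}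
    (hf : ContinuousOn f s) (hs : ∀ t ∈ Icc t₁ t₂, ∀ θ, conePoint (t, θ) ∈ s) :
    ContinuousOn (fun q => f (conePoint q)) (Icc t₁ t₂ ×ˢ univ) := by
  have hc : Continuous conePoint := by unfold conePoint; fun_prop
  exact hf.comp hc.continuousOn fun q hq => hs q.1 hq.1 q.2

theorem conePoint_mem_slab {t₁ t₂ : ℝ} (ht₁ : 0 < t₁) (ht₂ : t₂ ≤ 1) :
    ∀ t ∈ Icc t₁ t₂, ∀ θ, conePoint (t, θ) ∈ slab := fun _ ht _ =>
  ⟨⟨ht₁.trans_le ht.1, ht.2.trans ht₂⟩, mem_univ _⟩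

namespace IsClassical

variable {u : ℝ → Plane → Space}

theorem continuousOn_gramFlux (hu : IsClassical u) {t₁ t₂ : ℝ} (ht₁ : 0 < t₁) (ht₂ : t₂ ≤ 1) :
    ContinuousOn (fun q : ℝ × ℝ => gramFlux u q.2 (conePoint q)) (Icc t₁ t₂ ×ˢ univ) := by
  have hm := conePoint_mem_slab ht₁ ht₂
  refine (continuousOn_comp_conePoint hu.contDiffOn_gramEnergy.continuousOn hm).add
    (((continuousOn_comp_conePoint (hu.contDiffOn_gram 0 1).continuousOn hm).mul ?_).add
      ((continuousOn_comp_conePoint (hu.contDiffOn_gram 0 2).continuousOn hm).mul ?_)) <;>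
    exact Continuous.continuousOn (by fun_prop)

/-- Transport on the cone itself: `b = 0`, `c = 1`, unit weight. -/
theorem integral_gramFlux (hu : IsClassical u) {t₁ t₂ : ℝ} (ht₁ : 0 < t₁) (h12 : t₁ ≤ t₂)
    (ht₂ : t₂ ≤ 1) :
    ∫ t in t₁..t₂, ∫ θ in (0 : ℝ)..(2 * Real.pi), gramFlux u θ (conePoint (t, θ)) * t =
      (∫ x in Metric.ball (0 : Plane) t₂, gramEnergy u (t₂, x)) -
      ∫ x in Metric.ball (0 : Plane) t₁, gramEnergy u (t₁, x) := by
  have h := transport (b := 0) (c := 1) (Q := 0) h12 ht₁ ht₂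
    (fun t ht => by linarith [ht.1]) isOpen_univ
    (by simp) (hu.contDiffOn_gramEnergy.mono inter_subset_left)
    ((hu.contDiffOn_gram 0 1).mono inter_subset_left)
    ((hu.contDiffOn_gram 0 2).mono inter_subset_left) continuousOn_const
    (fun p hp _ => by rw [hu.fderiv_gramEnergy_time hp]; simp)
  simp only [zero_add, one_mul, Pi.zero_apply, integral_zero, intervalIntegral.integral_zero,
    sub_zero] at h
  rw [h]
  simp only [gramFlux, conePoint, mul_comm]

theorem flux_eq (hu : IsClassical u) {T : ℝ} (hT : T ∈ Ioo (0 : ℝ) 1) :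
    √2 * flux u 0 T =
      ∫ t in (0 : ℝ)..T, ∫ θ in (0 : ℝ)..(2 * Real.pi), gramFlux u θ (conePoint (t, θ)) * t := by
  have h2 : √2 * (1 / √2) = 1 := by field_simp
  rw [flux, ← mul_assoc, h2, one_mul, intervalIntegral.integral_of_le hT.1.le,
    intervalIntegral.integral_of_le hT.1.le]
  refine setIntegral_congr_fun measurableSet_Ioc fun t ht => ?_
  have ht' : t ∈ Ioc (0 : ℝ) 1 := ⟨ht.1, ht.2.trans hT.2.le⟩
  refine intervalIntegral.integral_congr fun θ _ => ?_
  have hx : (!₂[t * Real.cos θ, t * Real.sin θ] : Plane) = t • unitVec θ := by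
    ext i; fin_cases i <;> simp [unitVec]
  have h1 : ‖t • unitVec θ‖⁻¹ • t • unitVec θ = unitVec θ := by
    rw [norm_smul_unitVec ht.1.le, smul_smul, inv_mul_cancel₀ ht.1.ne', one_smul]
  have h3 : unitVec θ 0 = Real.cos θ := by simp [unitVec]
  have h4 : unitVec θ 1 = Real.sin θ := by simp [unitVec]
  simp only [hx, fluxDensity, h1, hu.energyDensity_eq ht', hu.dx_eq ht', hu.dt_eq ht', h3, h4,
    inner_add_left, inner_smul_left, conj_trivial, gramFlux, conePoint, gram]
  rw [real_inner_comm (pd u 0 _), real_inner_comm (pd u 0 _)]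
  ring

/-- The energy that leaves the cone between two positive times is bounded by the flux. -/
theorem integral_gramFlux_le (hu : IsClassical u) {a T : ℝ} (ha : 0 < a) (haT : a ≤ T)
    (hT : T ∈ Ioo (0 : ℝ) 1) :
    ∫ t in a..T, ∫ θ in (0 : ℝ)..(2 * Real.pi), gramFlux u θ (conePoint (t, θ)) * t ≤
      √2 * flux u 0 T := by
  set k : ℝ → ℝ := fun t =>
    ∫ θ in (0 : ℝ)..(2 * Real.pi), gramFlux u θ (conePoint (t, θ)) * t with hk
  have hk0 : ∀ t, 0 ≤ t → 0 ≤ k t := fun t ht =>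
    intervalIntegral.integral_nonneg Real.two_pi_pos.le fun θ _ =>
      mul_nonneg (gramFlux_nonneg u θ _) ht
  have hkint : ∀ s, 0 < s → s ≤ T → IntegrableOn k (Ioc s T) := fun s hs hsT => by
    have := intervalIntegrable_integral_angle (g := fun q => gramFlux u q.2 (conePoint q) * q.1)
      hsT ((hu.continuousOn_gramFlux hs hT.2.le).mul continuousOn_fst)
    rwa [intervalIntegrable_iff_integrableOn_Ioc_of_le hsT] at this
  have hlim : Filter.Tendsto (fun n : ℕ => T / (n + 1 : ℝ)) Filter.atTop (nhds 0) := by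
    simpa [Function.comp_def] using
      (tendsto_const_div_atTop_nhds_zero_nat T).comp (Filter.tendsto_add_atTop_nat 1)
  have hpos : ∀ n : ℕ, 0 < T / (n + 1 : ℝ) := fun n => div_pos hT.1 (by positivity)
  have hle : ∀ n : ℕ, T / (n + 1 : ℝ) ≤ T := fun n =>
    div_le_self hT.1.le (by linarith [n.cast_nonneg (α := ℝ)])
  -- The flux starts at the tip `t = 0`, where nothing is known about `u`, and a non-integrable `k`
  -- would make its integral zero by default. Integrability follows because the truncated integrals
  -- of the nonnegative `k` are bounded by the energy.
  have hint : IntegrableOn k (Ioc 0 T) := by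
    refine integrableOn_Ioc_of_intervalIntegral_norm_bounded_left (I := energy u T)
      (fun n => hkint _ (hpos n) (hle n)) hlim (Filter.Eventually.of_forall fun n => ?_)
    have h1 : ∫ t in Ioc (T / (n + 1 : ℝ)) T, ‖k t‖ = ∫ t in Ioc (T / (n + 1 : ℝ)) T, k t :=
      setIntegral_congr_fun measurableSet_Ioc fun t ht =>
        Real.norm_of_nonneg (hk0 t ((hpos n).trans ht.1).le)
    rw [h1, ← intervalIntegral.integral_of_le (hle n),
      hu.integral_gramFlux (hpos n) (hle n) hT.2.le]
    have h2 := hu.setIntegral_gramEnergy_le (Ioo_subset_Ioc_self hT) T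
    have h3 : 0 ≤ ∫ x in Metric.ball (0 : Plane) (T / (n + 1 : ℝ)),
        gramEnergy u (T / (n + 1 : ℝ), x) := integral_nonneg fun x => gramEnergy_nonneg u _
    linarith
  rw [hu.flux_eq hT, intervalIntegral.integral_of_le haT, intervalIntegral.integral_of_le hT.1.le]
  refine setIntegral_mono_set hint ?_ (Ioc_subset_Ioc_left ha.le).eventuallyLE
  exact (ae_restrict_mem measurableSet_Ioc).mono fun t ht => hk0 t ht.1.le

/-! ### The weighted identity and its boundary terms -/

theorem contDiffOn_weight_mul {f : ℝ × Plane → ℝ} (a : ℝ) (hf : ContDiffOn ℝ ∞ f slab) :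
    ContDiffOn ℝ ∞ (fun p => weight a p * f p) (slab ∩ shiftedCone a) :=
  ((contDiffOn_weight a).mono inter_subset_right).mul (hf.mono inter_subset_left)

/-- The weighted identity on the truncated light cone. -/
theorem integral_weight_current (hu : IsClassical u) {a T : ℝ} (ha : 0 < a) (haT : a ≤ T)
    (hT : T ≤ 1) :
    (∫ t in a..T, ∫ x in Metric.ball (0 : Plane) t, weight a (t, x) ^ 3 * gramX a u (t, x)) +
      (∫ x in Metric.ball (0 : Plane) T, weight a (T, x) * currentTime a u (T, x)) =
    (∫ x in Metric.ball (0 : Plane) a, weight a (a, x) * currentTime a u (a, x)) +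
    ∫ t in a..T, ∫ θ in (0 : ℝ)..(2 * Real.pi), t * (weight a (conePoint (t, θ)) *
      (currentTime a u (conePoint (t, θ)) +
        (currentSpace a u 1 0 (conePoint (t, θ)) * Real.cos θ +
          currentSpace a u 2 1 (conePoint (t, θ)) * Real.sin θ))) := by
  have h := transport (b := 0) (c := 1) haT ha hT
    (fun t ht => by linarith [ht.1]) (isOpen_shiftedCone a)
    (fun t _ x hx => show ‖x‖ < t + a by linarith)
    (contDiffOn_weight_mul a (hu.contDiffOn_currentTime a))
    (contDiffOn_weight_mul a (hu.contDiffOn_currentSpace a 1 0))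
    (contDiffOn_weight_mul a (hu.contDiffOn_currentSpace a 2 1))
    (Q := fun p => weight a p ^ 3 * gramX a u p)
    ((((contDiffOn_weight a).continuousOn.mono inter_subset_right).pow 3).mul
      ((hu.contDiffOn_gramX a).continuousOn.mono inter_subset_left))
    (fun p hp hpa => hu.divergence_weight_current a hp hpa)
  simp only [zero_add, one_mul] at h
  have h1 : ∀ t θ : ℝ, t * (weight a (t, t • unitVec θ) * currentTime a u (t, t • unitVec θ) +
      (weight a (t, t • unitVec θ) * currentSpace a u 1 0 (t, t • unitVec θ) * Real.cos θ +
        weight a (t, t • unitVec θ) * currentSpace a u 2 1 (t, t • unitVec θ) * Real.sin θ)) =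
      t * (weight a (conePoint (t, θ)) *
      (currentTime a u (conePoint (t, θ)) +
        (currentSpace a u 1 0 (conePoint (t, θ)) * Real.cos θ +
          currentSpace a u 2 1 (conePoint (t, θ)) * Real.sin θ))) := by
    intro t θ
    simp only [conePoint]
    ring
  simp only [h1] at h
  linarith

/-- On the cone `ρ_a² a (a + 2t) = 1`, so the product is `√((a + 2t)/a)` with `a = ε T` and `a + 2t
≤ 3T`. -/
theorem weight_conePoint_le {ε T t : ℝ} (hε : 0 < ε) (hε1 : ε < 1) (ht : 0 < t) (htT : t ≤ T)
    (θ : ℝ) : weight (ε * T) (conePoint (t, θ)) * (ε * T + 2 * t) ≤ √(3 / ε) := by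
  have hT : 0 < T := ht.trans_le htT
  have hεT : 0 < ε * T := mul_pos hε hT
  have hn : ‖(conePoint (t, θ)).2‖ = t := norm_smul_unitVec ht.le θ
  have hm : conePoint (t, θ) ∈ shiftedCone (ε * T) := by
    change ‖(conePoint (t, θ)).2‖ < t + ε * T
    linarith
  have hsq := weight_sq hm
  rw [hn] at hsq
  set w := weight (ε * T) (conePoint (t, θ))
  have h1 : w ^ 2 * (ε * T * (ε * T + 2 * t)) = 1 := by
    rw [← hsq]
    simp only [conePoint]
    ring
  refine Real.le_sqrt_of_sq_le ?_
  rw [le_div_iff₀ hε]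
  have h2 : (w * (ε * T + 2 * t)) ^ 2 * ε * T = ε * T + 2 * t := by
    linear_combination (ε * T + 2 * t) * h1
  have h3 : (w * (ε * T + 2 * t)) ^ 2 * ε * T ≤ 3 * T := by
    rw [h2]
    nlinarith
  exact le_of_mul_le_mul_right h3 hT

theorem integral_boundary_le (hu : IsClassical u) {ε T : ℝ} (hε : ε ∈ Ioo (0 : ℝ) 1)
    (hT : T ∈ Ioo (0 : ℝ) 1) :
    ∫ t in (ε * T)..T, ∫ θ in (0 : ℝ)..(2 * Real.pi), t * (weight (ε * T) (conePoint (t, θ)) *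
      (currentTime (ε * T) u (conePoint (t, θ)) +
        (currentSpace (ε * T) u 1 0 (conePoint (t, θ)) * Real.cos θ +
          currentSpace (ε * T) u 2 1 (conePoint (t, θ)) * Real.sin θ))) ≤
    √(3 / ε) * (√2 * flux u 0 T) := by
  have ha : 0 < ε * T := mul_pos hε.1 hT.1
  have haT : ε * T ≤ T := mul_le_of_le_one_left hT.1.le hε.2.le
  have hm := conePoint_mem_slab ha hT.2.le
  have hmw : ∀ t ∈ Icc (ε * T) T, ∀ θ, conePoint (t, θ) ∈ shiftedCone (ε * T) := by
    intro t ht θ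
    have : ‖(conePoint (t, θ)).2‖ = t := norm_smul_unitVec (ha.le.trans ht.1) θ
    change ‖(conePoint (t, θ)).2‖ < t + ε * T
    linarith
  refine le_trans ?_ (mul_le_mul_of_nonneg_left (hu.integral_gramFlux_le ha haT hT)
    (Real.sqrt_nonneg _))
  simp only [← intervalIntegral.integral_const_mul]
  refine integral_angle_mono (g := fun q => q.1 * (weight (ε * T) (conePoint q) *
      (currentTime (ε * T) u (conePoint q) +
        (currentSpace (ε * T) u 1 0 (conePoint q) * Real.cos q.2 +
          currentSpace (ε * T) u 2 1 (conePoint q) * Real.sin q.2))))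
    (h := fun q => √(3 / ε) * (gramFlux u q.2 (conePoint q) * q.1)) haT ?_ ?_ ?_
  · refine continuousOn_fst.mul ((continuousOn_comp_conePoint
      (contDiffOn_weight _).continuousOn hmw).mul ((continuousOn_comp_conePoint
      (hu.contDiffOn_currentTime _).continuousOn hm).add (((continuousOn_comp_conePoint
      (hu.contDiffOn_currentSpace _ 1 0).continuousOn hm).mul ?_).add ((continuousOn_comp_conePoint
      (hu.contDiffOn_currentSpace _ 2 1).continuousOn hm).mul ?_)))) <;>
      exact Continuous.continuousOn (by fun_prop)
  · exact continuousOn_const.mul ((hu.continuousOn_gramFlux ha hT.2.le).mul continuousOn_fst)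
  · intro t ht θ
    have ht0 : 0 < t := ha.trans_le ht.1
    have hf := gramFlux_nonneg u θ (conePoint (t, θ))
    calc _ ≤ t * (weight (ε * T) (conePoint (t, θ)) *
          ((ε * T + 2 * t) * gramFlux u θ (conePoint (t, θ)))) := by
          refine mul_le_mul_of_nonneg_left (mul_le_mul_of_nonneg_left
            (current_flux_le u (ε * T) ht0.le θ) (weight_pos (hmw t ht θ)).le) ht0.le
      _ = weight (ε * T) (conePoint (t, θ)) * (ε * T + 2 * t) *
          (gramFlux u θ (conePoint (t, θ)) * t) := by ring
      _ ≤ √(3 / ε) * (gramFlux u θ (conePoint (t, θ)) * t) :=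
          mul_le_mul_of_nonneg_right (weight_conePoint_le hε.1 hε.2 ht0 ht.2 θ)
            (mul_nonneg hf ht0.le)

theorem integrableOn_weight_mul {f : ℝ × Plane → ℝ} {a t : ℝ} (ha : 0 < a)
    (ht : t ∈ Ioc (0 : ℝ) 1) (hf : ContinuousOn f slab) :
    IntegrableOn (fun x => weight a (t, x) * f (t, x)) (Metric.ball (0 : Plane) t) := by
  refine (ContinuousOn.integrableOn_compact (isCompact_closedBall (0 : Plane) t)
    ?_).mono_set Metric.ball_subset_closedBall
  refine ContinuousOn.mul ((contDiffOn_weight a).continuousOn.comp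
    (Continuous.continuousOn (by fun_prop)) fun x hx => ?_) (hf.comp
    (Continuous.continuousOn (by fun_prop)) fun x _ => ⟨ht, mem_univ _⟩)
  have : ‖x‖ ≤ t := mem_closedBall_zero_iff.1 hx
  change ‖x‖ < t + a
  linarith

theorem integral_initial_le (hu : IsClassical u) {a : ℝ} (ha : a ∈ Ioc (0 : ℝ) 1) :
    ∫ x in Metric.ball (0 : Plane) a, weight a (a, x) * currentTime a u (a, x) ≤
      2 * energy u a := by
  have h1 : ∫ x in Metric.ball (0 : Plane) a, weight a (a, x) * currentTime a u (a, x) ≤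
      ∫ x in Metric.ball (0 : Plane) a, 2 * gramEnergy u (a, x) := by
    refine setIntegral_mono_on (integrableOn_weight_mul ha.1 ha
      (hu.contDiffOn_currentTime a).continuousOn) ?_ Metric.isOpen_ball.measurableSet ?_
    · exact ((continuous_const.mul (hu.continuous_gramEnergy ha)).continuousOn.integrableOn_compact
        (isCompact_closedBall (0 : Plane) a)).mono_set Metric.ball_subset_closedBall
    · intro x hx
      have hxa : ‖x‖ < a := mem_ball_zero_iff.1 hx
      have hm : ((a, x) : ℝ × Plane) ∈ shiftedCone a := by
        change ‖x‖ < a + a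
        linarith [ha.1]
      have hw := weight_pos hm
      have hsq := weight_sq hm
      have he := gramEnergy_nonneg u (a, x)
      have hr := inner_radial_le u (a, x) x
      have hr' := mul_le_mul_of_nonneg_right hxa.le he
      have hcur : currentTime a u (a, x) ≤ 3 * a * gramEnergy u (a, x) := by
        simp only [currentTime]
        linarith
      -- From `|x| ≤ a` one gets `3 a² ρ_a² ≤ 1`, hence `3 a ρ_a ≤ √3 ≤ 2`.
      have hb : weight a (a, x) * (3 * a) ≤ 2 := by
        simp only at hsq
        have : (weight a (a, x) * (3 * a)) ^ 2 ≤ 2 ^ 2 := by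
          have h3 : ‖x‖ ^ 2 ≤ a ^ 2 := pow_le_pow_left₀ (norm_nonneg x) hxa.le 2
          have h4 := mul_le_mul_of_nonneg_left h3 (sq_nonneg (weight a (a, x)))
          linarith
        exact le_of_sq_le_sq this (by norm_num)
      calc _ ≤ weight a (a, x) * (3 * a * gramEnergy u (a, x)) :=
            mul_le_mul_of_nonneg_left hcur hw.le
        _ = weight a (a, x) * (3 * a) * gramEnergy u (a, x) := by ring
        _ ≤ _ := mul_le_mul_of_nonneg_right hb he
  rw [integral_const_mul] at h1
  linarith [hu.setIntegral_gramEnergy_le ha a]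

theorem integral_final_le (hu : IsClassical u) {a T : ℝ} (ha : 0 < a)
    (hT : T ∈ Ioc (0 : ℝ) 1) :
    ∫ x in Metric.ball (0 : Plane) T, T * rho a T x *
        (energyDensity u T x + inner ℝ (dx u T x (T⁻¹ • x)) (dt u T x)) ≤
      ∫ x in Metric.ball (0 : Plane) T, weight a (T, x) * currentTime a u (T, x) := by
  -- The top integrand of the theorem is the current of the unshifted field (parameter `0`) with the
  -- shifted weight; passing to the shifted field adds `ρ_a a` times the energy density.
  have heq : ∀ x, T * rho a T x *
      (energyDensity u T x + inner ℝ (dx u T x (T⁻¹ • x)) (dt u T x)) =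
      weight a (T, x) * currentTime 0 u (T, x) := by
    intro x
    rw [hu.energyDensity_eq hT, hu.dx_eq hT, hu.dt_eq hT]
    simp only [PiLp.smul_apply, smul_eq_mul, inner_add_left, inner_smul_left, conj_trivial,
      currentTime, gram, weight, add_zero]
    rw [real_inner_comm (pd u 0 _), real_inner_comm (pd u 0 _)]
    have := hT.1.ne'
    field_simp
  simp only [heq]
  refine setIntegral_mono_on
    (integrableOn_weight_mul ha hT (hu.contDiffOn_currentTime 0).continuousOn)
    (integrableOn_weight_mul ha hT (hu.contDiffOn_currentTime a).continuousOn)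
    Metric.isOpen_ball.measurableSet fun x hx => ?_
  have hxT : ‖x‖ < T := mem_ball_zero_iff.1 hx
  have hm : ((T, x) : ℝ × Plane) ∈ shiftedCone a := by
    change ‖x‖ < T + a
    linarith
  refine mul_le_mul_of_nonneg_left ?_ (weight_pos hm).le
  have := mul_nonneg ha.le (gramEnergy_nonneg u (T, x))
  simp only [currentTime]
  linarith

theorem energy_nonneg (hu : IsClassical u) {t : ℝ} (ht : t ∈ Ioc (0 : ℝ) 1) : 0 ≤ energy u t :=
  integral_nonneg fun x => (hu.energyDensity_eq ht x).symm ▸ gramEnergy_nonneg u _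

theorem rho_mul_vectorFieldX (hu : IsClassical u) (a : ℝ) {t : ℝ} (ht : t ∈ Ioc (0 : ℝ) 1)
    (x : Plane) :
    rho a t x ^ 3 * ‖vectorFieldX a u t x‖ ^ 2 = weight a (t, x) ^ 3 * gramX a u (t, x) := by
  rw [vectorFieldX, hu.dt_eq ht, hu.dx_eq ht, weight, gramX]

end IsClassical

end WaveMap

/-! ### The main estimate -/

theorem mainTheorem6 :
    ∃ C : ℝ, 0 < C ∧
      ∀ (u : ℝ → WaveMap.Plane → WaveMap.Space) (_ : WaveMap.IsClassical u)
        (E : ℝ) (s : ℝ) (_ : s ∈ Set.Ioc (0 : ℝ) 1) (_ : WaveMap.energy u s = E)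
        (ε : ℝ) (_ : ε ∈ Set.Ioo (0 : ℝ) 1) (T : ℝ) (_ : T ∈ Set.Ioo (0 : ℝ) 1),
        WaveMap.flux u 0 T < ε * E →
        (∫ t in (ε * T)..T, ∫ x in Metric.ball (0 : WaveMap.Plane) t,
            WaveMap.rho (ε * T) t x ^ 3 * ‖WaveMap.vectorFieldX (ε * T) u t x‖ ^ 2) +
          (∫ x in Metric.ball (0 : WaveMap.Plane) T,
            T * WaveMap.rho (ε * T) T x *
              (WaveMap.energyDensity u T x +
                inner ℝ (WaveMap.dx u T x (T⁻¹ • x)) (WaveMap.dt u T x))) ≤ C * E := by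
  -- `6 = 2 + 4`: the bottom disc contributes `2 E`, the lateral boundary `4 E`.
  refine ⟨6, by norm_num, fun u hu E s hs hE ε hε T hT hflux => ?_⟩
  have ha : 0 < ε * T := mul_pos hε.1 hT.1
  have haT : ε * T ≤ T := mul_le_of_le_one_left hT.1.le hε.2.le
  have ha1 : ε * T ∈ Ioc (0 : ℝ) 1 := ⟨ha, haT.trans hT.2.le⟩
  have hE0 : 0 ≤ E := hE ▸ hu.energy_nonneg hs
  have hcone : ∫ t in (ε * T)..T, ∫ x in Metric.ball (0 : WaveMap.Plane) t,
      WaveMap.rho (ε * T) t x ^ 3 * ‖WaveMap.vectorFieldX (ε * T) u t x‖ ^ 2 =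
      ∫ t in (ε * T)..T, ∫ x in Metric.ball (0 : WaveMap.Plane) t,
        WaveMap.weight (ε * T) (t, x) ^ 3 * WaveMap.gramX (ε * T) u (t, x) := by
    refine intervalIntegral.integral_congr fun t ht => ?_
    rw [uIcc_of_le haT] at ht
    simp only [hu.rho_mul_vectorFieldX (ε * T) ⟨ha.trans_le ht.1, ht.2.trans hT.2.le⟩]
  have hid := hu.integral_weight_current ha haT hT.2.le
  have hfin := hu.integral_final_le ha (Ioo_subset_Ioc_self hT)
  have hini := hu.integral_initial_le ha1
  rw [hu.energy_eq ha1 hs, hE] at hini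
  have hbd := hu.integral_boundary_le hε hT
  have hfl : √(3 / ε) * (√2 * WaveMap.flux u 0 T) ≤ 4 * E := by
    -- `√(3/ε) ε = √(3ε) < √3`: the small flux outweighs the `ε^{-1/2}` growth of the weighted
    -- current on the cone.
    have h1 : √(3 / ε) * ε ≤ 2 := by
      suffices h : (√(3 / ε) * ε) ^ 2 ≤ 2 ^ 2 from le_of_sq_le_sq h (by norm_num)
      rw [mul_pow, Real.sq_sqrt (div_nonneg (by norm_num) hε.1.le)]
      have h2 : 3 / ε * ε ^ 2 = 3 * ε := by
        have := hε.1.ne'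
        field_simp
      linarith [hε.2]
    have h3 : √2 ≤ 2 := Real.sqrt_le_iff.2 ⟨by norm_num, by norm_num⟩
    calc √(3 / ε) * (√2 * WaveMap.flux u 0 T) ≤ √(3 / ε) * (√2 * (ε * E)) := by gcongr
      _ = (√(3 / ε) * ε) * √2 * E := by ring
      _ ≤ 2 * 2 * E := by gcongr
      _ = 4 * E := by ring
  linarith
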